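/- Call a real function (or a sequence) *ultimately increasing* if it is strictly increasing for all sufficiently large arguments. A *Pisot number* is an algebraic integer $\beta>1$ all of whose conjugates other than $\beta$ have absolute value less than $1$; a *Salem number* is an algebraic integer $\beta>1$ all of whose conjugates other than $\beta$ have absolute value at most $1$, at least one of them having absolute value exactly $1$. **Theorem.** Let $m_0\ge 0$ be an integer and let $a(R),u(R)$ be ultimately increasing real-valued functions on $[m_0,\infty)$ such that the sequences $(\lfloor a(m)\rfloor)_{m\ge m_0}$ and $(\lfloor u(m)\rfloor)_{m\ge m_0}$ are also ultimately increasing. Suppose that $a$ and $u$ have inverse functions $b(R)$ and $v(R)$, respectively, defined for all sufficiently large $R$. Assume that 1. $\dfrac{\log a(R)}{\log R}$ is ultimately increasing and $\displaystyle\lim_{R\to\infty}\frac{\log a(R)}{\log R}=\infty$; 2. $a$ is differentiable, and for every $\varepsilon>0$ there is a constant $C(\varepsilon)>0$ such that $(\log a)'(R)<R^{-1+\varepsilon}$ for all $R\ge C(\varepsilon)$; 3. there is a constant $C>0$ such that $\dfrac{u(R+1)}{u(R)}<C$ for all sufficiently large $R$; 4. $\displaystyle\lim_{R\to\infty}\frac{\log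 b(R)}{\log v(R)}=\infty$. Then, for every Pisot or Salem number $\beta$, the two series $$\sum_{m=m_0}^{\infty}\beta^{-\lfloor a(m)\rfloor},\qquad \sum_{m=m_0}^{\infty}\beta^{-\lfloor u(m)\rfloor}$$ converge and their sums are algebraically independent (over $\mathbb{Q}$). -/

import Mathlib

/-- A Pisot number: an algebraic integer `β > 1` all of whose other conjugates (the complex roots
of its minimal polynomial over `ℚ`) have absolute value less than `1`. -/
def IsPisotNumber (β : ℝ) : Prop :=
  1 < β ∧ IsIntegral ℤ β ∧
    ∀ z ∈ (minpoly ℚ β).aroots ℂ, z ≠ (β : ℂ) → ‖z‖ < 1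

/-- A Salem number: an algebraic integer `β > 1` all of whose other conjugates have absolute value
at most `1`, at least one conjugate having absolute value exactly `1`. -/
def IsSalemNumber (β : ℝ) : Prop :=
  1 < β ∧ IsIntegral ℤ β ∧
    (∀ z ∈ (minpoly ℚ β).aroots ℂ, z ≠ (β : ℂ) → ‖z‖ ≤ 1) ∧
    ∃ z ∈ (minpoly ℚ β).aroots ℂ, ‖z‖ = 1

/-- A function of a real variable, or a sequence, is ultimately increasing if it is strictly
increasing for all sufficiently large arguments. -/
def UltimatelyIncreasing {α γ : Type*} [Preorder α] [Preorder γ] (f : α → γ) : Prop :=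
  ∃ x₀ : α, StrictMonoOn f (Set.Ici x₀)

/-- `b` is, for sufficiently large arguments, the inverse function of the ultimately increasing
function `a` on `[m₀, ∞)`: from some point `x₀ ≥ m₀` on, `a` and `b` are mutually inverse strictly
increasing maps between `[x₀, ∞)` and `[a x₀, ∞)`. -/
def IsUltimateInverse (m₀ : ℕ) (a b : ℝ → ℝ) : Prop :=
  ∃ x₀ : ℝ, (m₀ : ℝ) ≤ x₀ ∧ StrictMonoOn a (Set.Ici x₀) ∧
    Set.MapsTo b (Set.Ici (a x₀)) (Set.Ici x₀) ∧
    Set.InvOn b a (Set.Ici x₀) (Set.Ici (a x₀))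

/-! Up to algebraic constants, the two sums are ξ = Σ β^(-s), s ∈ S, and η = Σ β^(-t), t ∈ T, where
S and T consist of 0 and the late integer parts of a and u. Suppose P(ξ, η) = 0 and multiply by ξη.
The product ξ^k η^l is a series in β⁻¹ with nonnegative digits of polynomial size, nonzero exactly
on the sumset kS + lT, so the relation becomes a vanishing series with integer digits.

Arithmetic: cut this series at position R. Since the whole vanishes, the tail is minus a polynomial
value at β with integer coefficients, and its other conjugates are polynomially bounded in R because
those of β lie in the closed unit disc. The norm of a nonzero algebraic integer is at least 1 in
absolute value, so a nonzero tail is at least a negative power of R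
(`exists_one_le_abs_digitTail_mul`). A long run of zero digits would make it exponentially small.
Hence no long run of zeros can precede a digit of the lexicographically leading monomial that is
isolated from all other monomials (`exists_forall_not_gap`).

Combinatorics: such a run does exist (`exists_isolated_sum`). Sumsets of sparse sets leave long
gaps. In a gap of the monomials with smaller S-exponent, greedy approximation by S produces a sum
with the leading S-exponent; there one passes to a gap of the sums with one T-summand fewer, and
adds a suitable element of T to the last sum before that gap.

Analysis: the growth conditions supply arbitrarily large scales N, μ at which S has few elements but
small relative gaps, while T has at most μ elements (`exists_sparse_scale`). -/

open scoped Pointwise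

/-! ### Lower bounds from the norm -/

/-- An algebraic integer whose conjugates are controlled cannot be too close to zero. -/
theorem exists_one_le_abs_aeval_mul_pow {β : ℝ} (hβ : IsIntegral ℤ β) :
    ∃ E : ℕ, ∀ (g : Polynomial ℤ) (B : ℝ), 1 ≤ B →
      (∀ z ∈ (minpoly ℚ β).aroots ℂ, z ≠ (β : ℂ) → ‖Polynomial.aeval z g‖ ≤ B) →
      Polynomial.aeval β g ≠ 0 → 1 ≤ |Polynomial.aeval β g| * B ^ E := by
  classical
  have hβQ : IsIntegral ℚ β := hβ.tower_top
  have : FiniteDimensional ℚ (IntermediateField.adjoin ℚ {β}) :=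
    IntermediateField.adjoin.finiteDimensional hβQ
  set K := IntermediateField.adjoin ℚ {β} with hK
  let γ : K := IntermediateField.AdjoinSimple.gen ℚ β
  have hγ : algebraMap K ℝ γ = β := IntermediateField.AdjoinSimple.algebraMap_gen ℚ β
  let σ₀ : K →ₐ[ℚ] ℂ := (Complex.ofRealAm.restrictScalars ℚ).comp K.val
  have hσ₀ : σ₀ γ = (β : ℂ) := by
    change ((K.val γ : ℝ) : ℂ) = _
    rw [show K.val γ = β from hγ]
  have hσ (σ : K →ₐ[ℚ] ℂ) (h : σ ≠ σ₀) : σ γ ≠ (β : ℂ) := by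
    intro h'
    refine h (IntermediateField.algHom_ext_of_eq_adjoin ℚ hK ?_)
    rintro y rfl
    exact h'.trans hσ₀.symm
  have hroot (σ : K →ₐ[ℚ] ℂ) : σ γ ∈ (minpoly ℚ β).aroots ℂ := by
    rw [Polynomial.mem_aroots]
    refine ⟨minpoly.ne_zero hβQ, ?_⟩
    have : Polynomial.aeval γ (minpoly ℚ β) = 0 := by
      apply (algebraMap K ℝ).injective
      rw [← Polynomial.aeval_algebraMap_apply, hγ, minpoly.aeval, map_zero]
    rw [Polynomial.aeval_algHom_apply, this, map_zero]
  -- One factor `B` for each embedding other than the real one `σ₀`; this count does not depend on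
  -- `g`.
  refine ⟨(Finset.univ.erase σ₀).card, fun g B hB hg hne => ?_⟩
  set x : K := Polynomial.aeval γ g with hx
  have hxβ : algebraMap K ℝ x = Polynomial.aeval β g := by
    rw [hx, ← Polynomial.aeval_algebraMap_apply, hγ]
  have hx0 : x ≠ 0 := by
    intro h0
    apply hne
    rw [← hxβ, h0, map_zero]
  have hσx (σ : K →ₐ[ℚ] ℂ) : σ x = Polynomial.aeval (σ γ) g := by
    rw [hx]
    exact (Polynomial.aeval_algHom_apply (σ.restrictScalars ℤ) γ g).symm
  have hγint : IsIntegral ℤ γ := by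
    rw [← isIntegral_algebraMap_iff (algebraMap K ℝ).injective, hγ]; exact hβ
  have hxint : IsIntegral ℤ x := by
    rw [hx]
    exact IsIntegral.of_mem_of_fg _ hγint.fg_adjoin_singleton _
      (Polynomial.aeval_mem_adjoin_singleton ℤ γ)
  -- The norm of `x` is a rational algebraic integer, hence an integer `m`; it is nonzero, so the
  -- product over all embeddings has absolute value at least 1.
  obtain ⟨m, hm⟩ := (IsIntegrallyClosed.isIntegral_iff (R := ℤ) (K := ℚ)).1
    (Algebra.isIntegral_norm ℚ hxint)
  have hm0 : m ≠ 0 := by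
    rintro rfl
    apply hx0
    rw [← Algebra.norm_eq_zero_iff (R := ℚ), ← hm, map_zero]
  have hprod := Algebra.norm_eq_prod_embeddings ℚ ℂ x
  rw [← hm, ← Finset.mul_prod_erase _ _ (Finset.mem_univ σ₀)] at hprod
  have h1 : (1 : ℝ) ≤ ‖(algebraMap ℚ ℂ) ((algebraMap ℤ ℚ) m)‖ := by
    simp only [eq_intCast, map_intCast, Complex.norm_intCast]
    exact_mod_cast Int.one_le_abs hm0
  rw [hprod, norm_mul, norm_prod] at h1
  refine h1.trans (mul_le_mul (le_of_eq ?_) ?_ (by positivity) (abs_nonneg _))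
  · rw [hσx, hσ₀]
    have : Polynomial.aeval (β : ℂ) g = ((Polynomial.aeval β g : ℝ) : ℂ) :=
      Polynomial.aeval_algebraMap_apply ℂ β g
    rw [this, Complex.norm_real, Real.norm_eq_abs]
  · rw [← Finset.prod_const]
    refine Finset.prod_le_prod (fun _ _ => norm_nonneg _) fun σ h => ?_
    rw [hσx]
    exact hg _ (hroot σ) (hσ σ (Finset.ne_of_mem_erase h))

/-! ### Digit sequences and their tails -/

/-- A sequence of integers of at most polynomial growth. -/
def IsPolyBounded (h : ℕ → ℤ) : Prop :=
  ∃ c D : ℕ, ∀ n, |(h n : ℝ)| ≤ c * ((n : ℝ) + 1) ^ D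

/-- The series with digits `h` and ratio `z`, started at the digit number `R`. -/
noncomputable def digitTail (z : ℝ) (h : ℕ → ℤ) (R : ℕ) : ℝ := ∑' j : ℕ, (h (R + j) : ℝ) * z ^ j

theorem IsPolyBounded.add {h₁ h₂ : ℕ → ℤ} (H₁ : IsPolyBounded h₁) (H₂ : IsPolyBounded h₂) :
    IsPolyBounded (h₁ + h₂) := by
  obtain ⟨c₁, D₁, H₁⟩ := H₁
  obtain ⟨c₂, D₂, H₂⟩ := H₂
  refine ⟨c₁ + c₂, D₁ + D₂, fun n => ?_⟩
  have hn : (1 : ℝ) ≤ (n : ℝ) + 1 := by linarith [n.cast_nonneg (α := ℝ)]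
  have e₁ : ((n : ℝ) + 1) ^ D₁ ≤ ((n : ℝ) + 1) ^ (D₁ + D₂) := pow_le_pow_right₀ hn (by omega)
  have e₂ : ((n : ℝ) + 1) ^ D₂ ≤ ((n : ℝ) + 1) ^ (D₁ + D₂) := pow_le_pow_right₀ hn (by omega)
  calc |((h₁ + h₂) n : ℝ)| ≤ |(h₁ n : ℝ)| + |(h₂ n : ℝ)| := by
        rw [Pi.add_apply, Int.cast_add]; exact abs_add_le _ _
    _ ≤ c₁ * ((n : ℝ) + 1) ^ (D₁ + D₂) + c₂ * ((n : ℝ) + 1) ^ (D₁ + D₂) := by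
        refine add_le_add ((H₁ n).trans ?_) ((H₂ n).trans ?_) <;> gcongr
    _ = _ := by push_cast; ring

theorem IsPolyBounded.const_mul {h : ℕ → ℤ} (H : IsPolyBounded h) (A : ℤ) :
    IsPolyBounded (fun n => A * h n) := by
  obtain ⟨c, D, H⟩ := H
  refine ⟨A.natAbs * c, D, fun n => ?_⟩
  have : ((A.natAbs : ℕ) : ℝ) = |(A : ℝ)| := by rw [Nat.cast_natAbs, Int.cast_abs]
  rw [Int.cast_mul, abs_mul, Nat.cast_mul, this, mul_assoc]
  gcongr
  exact H n

theorem isPolyBounded_zero : IsPolyBounded 0 := ⟨0, 0, fun n => by simp⟩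

theorem IsPolyBounded.sum {ι : Type*} (s : Finset ι) {h : ι → ℕ → ℤ}
    (H : ∀ i ∈ s, IsPolyBounded (h i)) : IsPolyBounded (∑ i ∈ s, h i) :=
  Finset.sum_induction _ IsPolyBounded (fun _ _ => IsPolyBounded.add) isPolyBounded_zero H

section Tail

variable {z : ℝ}

theorem summable_succ_pow_mul_pow (hz₀ : 0 < z) (hz₁ : z < 1) (D : ℕ) :
    Summable fun j : ℕ => ((j : ℝ) + 1) ^ D * z ^ j := by
  have h := (summable_nat_add_iff 1).2
    (summable_pow_mul_geometric_of_norm_lt_one D (r := z) (by rwa [Real.norm_of_nonneg hz₀.le]))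
  have h2 := h.mul_right z⁻¹
  refine h2.congr fun j => ?_
  push_cast
  rw [pow_succ]
  field_simp

theorem IsPolyBounded.shift_le {h : ℕ → ℤ} {c D : ℕ}
    (H : ∀ n : ℕ, |(h n : ℝ)| ≤ c * ((n : ℝ) + 1) ^ D) (hz₀ : 0 < z) (R j : ℕ) :
    ‖(h (R + j) : ℝ) * z ^ j‖ ≤ c * ((R : ℝ) + 1) ^ D * (((j : ℝ) + 1) ^ D * z ^ j) := by
  rw [norm_mul, Real.norm_eq_abs, Real.norm_of_nonneg (by positivity : 0 ≤ z ^ j)]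
  have : ((R + j : ℕ) : ℝ) + 1 ≤ ((R : ℝ) + 1) * ((j : ℝ) + 1) := by
    push_cast
    nlinarith [mul_nonneg (R.cast_nonneg (α := ℝ)) (j.cast_nonneg (α := ℝ))]
  calc |(h (R + j) : ℝ)| * z ^ j ≤ (c * (((R + j : ℕ) : ℝ) + 1) ^ D) * z ^ j := by
        gcongr; exact H _
    _ ≤ (c * (((R : ℝ) + 1) * ((j : ℝ) + 1)) ^ D) * z ^ j := by gcongr
    _ = _ := by rw [mul_pow]; ring

theorem IsPolyBounded.summable_norm {h : ℕ → ℤ} (H : IsPolyBounded h) (hz₀ : 0 < z) (hz₁ : z < 1)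
    (R : ℕ) : Summable fun j : ℕ => ‖(h (R + j) : ℝ) * z ^ j‖ := by
  obtain ⟨c, D, H⟩ := H
  exact Summable.of_nonneg_of_le (fun _ => norm_nonneg _) (shift_le H hz₀ R)
    ((summable_succ_pow_mul_pow hz₀ hz₁ D).mul_left _)

theorem IsPolyBounded.summable {h : ℕ → ℤ} (H : IsPolyBounded h) (hz₀ : 0 < z) (hz₁ : z < 1)
    (R : ℕ) : Summable fun j : ℕ => (h (R + j) : ℝ) * z ^ j :=
  (H.summable_norm hz₀ hz₁ R).of_norm

theorem IsPolyBounded.abs_digitTail_le {h : ℕ → ℤ} (H : IsPolyBounded h) (hz₀ : 0 < z)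
    (hz₁ : z < 1) : ∃ c D : ℕ, ∀ R : ℕ, |digitTail z h R| ≤ c * ((R : ℝ) + 1) ^ D := by
  obtain ⟨c, D, H⟩ := H
  obtain ⟨c', hc'⟩ := exists_nat_ge (∑' j : ℕ, ((j : ℝ) + 1) ^ D * z ^ j)
  refine ⟨c * c', D, fun R => ?_⟩
  have h1 := tsum_of_norm_bounded
    (((summable_succ_pow_mul_pow hz₀ hz₁ D).mul_left (c * ((R : ℝ) + 1) ^ D)).hasSum)
    (IsPolyBounded.shift_le H hz₀ R)
  rw [tsum_mul_left] at h1
  calc |digitTail z h R| ≤ _ := h1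
    _ ≤ (c * ((R : ℝ) + 1) ^ D) * c' := by gcongr
    _ = _ := by push_cast; ring

theorem digitTail_eq_add {h : ℕ → ℤ} (H : IsPolyBounded h) (hz₀ : 0 < z) (hz₁ : z < 1)
    (R w : ℕ) : digitTail z h R =
      ∑ j ∈ Finset.range w, (h (R + j) : ℝ) * z ^ j + z ^ w * digitTail z h (R + w) := by
  rw [digitTail, ← (H.summable hz₀ hz₁ R).sum_add_tsum_nat_add w, digitTail, ← tsum_mul_left]
  congr 1
  refine tsum_congr fun j => ?_
  rw [show R + (j + w) = R + w + j by ring, pow_add]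
  ring

theorem digitTail_eq_pow_mul {h : ℕ → ℤ} (H : IsPolyBounded h) (hz₀ : 0 < z) (hz₁ : z < 1)
    {R w : ℕ} (hw : ∀ j < w, h (R + j) = 0) :
    digitTail z h R = z ^ w * digitTail z h (R + w) := by
  rw [digitTail_eq_add H hz₀ hz₁ R w, Finset.sum_eq_zero, zero_add]
  intro j hj
  rw [hw j (Finset.mem_range.1 hj), Int.cast_zero, zero_mul]

theorem pow_mul_digitTail_le {h : ℕ → ℤ} (H : IsPolyBounded h) (hz₀ : 0 < z) (hz₁ : z < 1)
    {R w : ℕ} (hw : ∀ j < w, 0 ≤ h (R + j)) :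
    z ^ w * digitTail z h (R + w) ≤ digitTail z h R := by
  rw [digitTail_eq_add H hz₀ hz₁ R w]
  have : 0 ≤ ∑ j ∈ Finset.range w, (h (R + j) : ℝ) * z ^ j :=
    Finset.sum_nonneg fun j hj =>
      mul_nonneg (Int.cast_nonneg (hw j (Finset.mem_range.1 hj))) (by positivity)
  linarith

theorem le_digitTail_of_nonneg {h : ℕ → ℤ} (H : IsPolyBounded h) (hz₀ : 0 < z) (hz₁ : z < 1)
    (h0 : ∀ n, 0 ≤ h n) (R : ℕ) : (h R : ℝ) ≤ digitTail z h R := by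
  have := (H.summable hz₀ hz₁ R).le_tsum 0
    (fun j _ => mul_nonneg (Int.cast_nonneg (h0 _)) (by positivity))
  simpa [digitTail] using this

theorem digitTail_add {h₁ h₂ : ℕ → ℤ} (H₁ : IsPolyBounded h₁) (H₂ : IsPolyBounded h₂)
    (hz₀ : 0 < z) (hz₁ : z < 1) (R : ℕ) :
    digitTail z (h₁ + h₂) R = digitTail z h₁ R + digitTail z h₂ R := by
  rw [digitTail, digitTail, digitTail,
    ← (H₁.summable hz₀ hz₁ R).tsum_add (H₂.summable hz₀ hz₁ R)]
  refine tsum_congr fun j => ?_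
  rw [Pi.add_apply, Int.cast_add, add_mul]

theorem digitTail_const_mul (z : ℝ) (h : ℕ → ℤ) (A : ℤ) (R : ℕ) :
    digitTail z (fun n => A * h n) R = A * digitTail z h R := by
  rw [digitTail, digitTail, ← tsum_mul_left]
  refine tsum_congr fun j => ?_
  rw [Int.cast_mul, mul_assoc]

theorem digitTail_zero_fun (z : ℝ) (R : ℕ) : digitTail z 0 R = 0 := by
  simp [digitTail]

theorem digitTail_sum {ι : Type*} (s : Finset ι) {h : ι → ℕ → ℤ}
    (H : ∀ i ∈ s, IsPolyBounded (h i)) (hz₀ : 0 < z) (hz₁ : z < 1) (R : ℕ) :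
    digitTail z (∑ i ∈ s, h i) R = ∑ i ∈ s, digitTail z (h i) R := by
  classical
  induction s using Finset.induction_on with
  | empty => simp [digitTail_zero_fun]
  | insert a s ha ih =>
    rw [Finset.sum_insert ha, Finset.sum_insert ha,
      digitTail_add (H a (Finset.mem_insert_self _ _))
        (IsPolyBounded.sum s fun i hi => H i (Finset.mem_insert_of_mem hi)) hz₀ hz₁,
      ih fun i hi => H i (Finset.mem_insert_of_mem hi)]

end Tail

/-! ### Products of series and sumsets of exponents -/

/-- The coefficients of a power series with natural coefficients, as a sequence of integers. -/
noncomputable def coeffSeq (p : PowerSeries ℕ) : ℕ → ℤ := fun n => ((PowerSeries.coeff n p : ℕ) : ℤ)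

theorem coeffSeq_nonneg (p : PowerSeries ℕ) (n : ℕ) : 0 ≤ coeffSeq p n := Int.natCast_nonneg _

theorem IsPolyBounded.coeffSeq_mul {p q : PowerSeries ℕ} (hp : IsPolyBounded (coeffSeq p))
    (hq : IsPolyBounded (coeffSeq q)) : IsPolyBounded (coeffSeq (p * q)) := by
  obtain ⟨c₁, D₁, H₁⟩ := hp
  obtain ⟨c₂, D₂, H₂⟩ := hq
  -- The extra degree pays for the n + 1 terms of the convolution.
  refine ⟨c₁ * c₂, D₁ + D₂ + 1, fun n => ?_⟩
  simp only [coeffSeq, Int.cast_natCast, Nat.abs_cast] at H₁ H₂ ⊢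
  rw [PowerSeries.coeff_mul]
  push_cast
  calc ∑ x ∈ Finset.HasAntidiagonal.antidiagonal n, ((PowerSeries.coeff x.1 p : ℕ) : ℝ) * ((PowerSeries.coeff x.2 q : ℕ) : ℝ)
      ≤ ∑ x ∈ Finset.HasAntidiagonal.antidiagonal n, (c₁ * ((n : ℝ) + 1) ^ D₁) * (c₂ * ((n : ℝ) + 1) ^ D₂) := by
        refine Finset.sum_le_sum fun x hx => ?_
        have hx' := Finset.HasAntidiagonal.mem_antidiagonal.1 hx
        have a1 : (x.1 : ℝ) ≤ n := by exact_mod_cast (by omega : x.1 ≤ n)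
        have a2 : (x.2 : ℝ) ≤ n := by exact_mod_cast (by omega : x.2 ≤ n)
        refine mul_le_mul ((H₁ _).trans ?_) ((H₂ _).trans ?_) (by positivity) (by positivity) <;>
          gcongr
    _ = _ := by
        rw [Finset.sum_const, Finset.Nat.card_antidiagonal, nsmul_eq_mul]
        push_cast
        ring

theorem isPolyBounded_coeffSeq_one : IsPolyBounded (coeffSeq 1) := by
  refine ⟨1, 0, fun n => ?_⟩
  simp only [coeffSeq, PowerSeries.coeff_one]
  split_ifs <;> simp

theorem IsPolyBounded.coeffSeq_pow {p : PowerSeries ℕ} (hp : IsPolyBounded (coeffSeq p)) (k : ℕ) :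
    IsPolyBounded (coeffSeq (p ^ k)) := by
  induction k with
  | zero => simpa using isPolyBounded_coeffSeq_one
  | succ k ih => rw [pow_succ]; exact ih.coeffSeq_mul hp

theorem digitTail_coeffSeq_mul {z : ℝ} (hz₀ : 0 < z) (hz₁ : z < 1) {p q : PowerSeries ℕ}
    (hp : IsPolyBounded (coeffSeq p)) (hq : IsPolyBounded (coeffSeq q)) :
    digitTail z (coeffSeq (p * q)) 0 =
      digitTail z (coeffSeq p) 0 * digitTail z (coeffSeq q) 0 := by
  have h1 := hp.summable_norm hz₀ hz₁ 0
  have h2 := hq.summable_norm hz₀ hz₁ 0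
  rw [digitTail, digitTail, digitTail,
    tsum_mul_tsum_eq_tsum_sum_antidiagonal_of_summable_norm h1 h2]
  refine tsum_congr fun n => ?_
  simp only [zero_add, coeffSeq, PowerSeries.coeff_mul, Int.cast_natCast]
  push_cast
  rw [Finset.sum_mul]
  refine Finset.sum_congr rfl fun x hx => ?_
  rw [← Finset.HasAntidiagonal.mem_antidiagonal.1 hx, pow_add]
  ring

theorem digitTail_coeffSeq_pow {z : ℝ} (hz₀ : 0 < z) (hz₁ : z < 1) {p : PowerSeries ℕ}
    (hp : IsPolyBounded (coeffSeq p)) (k : ℕ) :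
    digitTail z (coeffSeq (p ^ k)) 0 = digitTail z (coeffSeq p) 0 ^ k := by
  induction k with
  | zero =>
    rw [pow_zero, pow_zero, digitTail, tsum_eq_single 0]
    · simp [coeffSeq]
    · intro n hn
      simp [coeffSeq, PowerSeries.coeff_one, hn]
  | succ k ih =>
    rw [pow_succ, pow_succ, digitTail_coeffSeq_mul hz₀ hz₁ (hp.coeffSeq_pow k) hp, ih]

/-- The exponents that occur in a power series with natural coefficients. -/
def coeffSupport (p : PowerSeries ℕ) : Set ℕ := {n | PowerSeries.coeff n p ≠ 0}

/-- Coefficients in ℕ cannot cancel: a coefficient of the product vanishes only if every term of the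
convolution does. This gives equality instead of mere inclusion. -/
theorem coeffSupport_mul (p q : PowerSeries ℕ) :
    coeffSupport (p * q) = coeffSupport p + coeffSupport q := by
  ext n
  simp only [coeffSupport, Set.mem_ofPred_eq, Set.mem_add, PowerSeries.coeff_mul, ne_eq,
    Finset.sum_eq_zero_iff, not_forall, mul_eq_zero, not_or, Prod.exists]
  constructor
  · rintro ⟨i, j, hij, h1, h2⟩
    exact ⟨i, h1, j, h2, Finset.HasAntidiagonal.mem_antidiagonal.1 hij⟩
  · rintro ⟨i, h1, j, h2, hij⟩
    exact ⟨i, j, Finset.HasAntidiagonal.mem_antidiagonal.2 hij, h1, h2⟩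

theorem coeffSupport_pow (p : PowerSeries ℕ) (k : ℕ) :
    coeffSupport (p ^ k) = k • coeffSupport p := by
  induction k with
  | zero =>
    ext n
    simp [coeffSupport, PowerSeries.coeff_one]
  | succ k ih => rw [pow_succ, coeffSupport_mul, ih, succ_nsmul]

/-! ### Tails of a vanishing series -/

/-- If the series with digits `h` vanishes at `β⁻¹`, its nonzero tails are not too small. -/
theorem exists_one_le_abs_digitTail_mul {β : ℝ} (hβ₁ : 1 < β) (hβ : IsIntegral ℤ β)
    (hconj : ∀ z ∈ (minpoly ℚ β).aroots ℂ, z ≠ (β : ℂ) → ‖z‖ ≤ 1) {h : ℕ → ℤ}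
    (H : IsPolyBounded h) (h0 : digitTail β⁻¹ h 0 = 0) :
    ∃ c E : ℕ, ∀ R : ℕ, digitTail β⁻¹ h R ≠ 0 →
      1 ≤ |digitTail β⁻¹ h R| * (c * ((R : ℝ) + 1) ^ E) := by
  have hβ0 : 0 < β := by linarith
  obtain ⟨E, hE⟩ := exists_one_le_abs_aeval_mul_pow hβ
  obtain ⟨c, D, hc⟩ := id H
  refine ⟨(c + 1) ^ E, (D + 1) * E, fun R hR => ?_⟩
  -- The head of the series, multiplied by β^R. As head and tail sum to zero, its value at β is
  -- minus the tail at `R`.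
  let g : Polynomial ℤ := ∑ m ∈ Finset.range R, Polynomial.monomial (R - m) (h m)
  have hg : Polynomial.aeval β g = - digitTail β⁻¹ h R := by
    have h1 := digitTail_eq_add H (inv_pos.2 hβ0) (inv_lt_one_of_one_lt₀ hβ₁) 0 R
    rw [h0, zero_add] at h1
    have h2 : digitTail β⁻¹ h R =
        - (β ^ R * ∑ j ∈ Finset.range R, (h (0 + j) : ℝ) * β⁻¹ ^ j) := by
      have : β ^ R * β⁻¹ ^ R = 1 := by rw [← mul_pow, mul_inv_cancel₀ hβ0.ne', one_pow]
      calc digitTail β⁻¹ h R = (β ^ R * β⁻¹ ^ R) * digitTail β⁻¹ h R := by rw [this, one_mul]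
        _ = _ := by linear_combination (-(β ^ R)) * h1
    rw [h2, neg_neg, map_sum, Finset.mul_sum]
    refine Finset.sum_congr rfl fun m hm => ?_
    rw [Polynomial.aeval_monomial, zero_add, eq_intCast,
      pow_sub₀ β hβ0.ne' (Finset.mem_range.1 hm).le, inv_pow]
    ring
  have hB : (1 : ℝ) ≤ (c + 1) * ((R : ℝ) + 1) ^ (D + 1) := by
    have e1 : (1 : ℝ) ≤ ((R : ℝ) + 1) ^ (D + 1) :=
      one_le_pow₀ (by linarith [R.cast_nonneg (α := ℝ)])
    nlinarith [c.cast_nonneg (α := ℝ)]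
  have key := hE g _ hB (fun z hz hne => ?_) (by rw [hg]; simpa using hR)
  · rw [hg, abs_neg, mul_pow, ← pow_mul] at key
    push_cast
    exact key
  · have hz1 := hconj z hz hne
    rw [map_sum]
    calc ‖∑ m ∈ Finset.range R, Polynomial.aeval z (Polynomial.monomial (R - m) (h m))‖
        ≤ ∑ m ∈ Finset.range R, (c : ℝ) * ((R : ℝ) + 1) ^ D := by
          refine norm_sum_le_of_le _ fun m hm => ?_
          rw [Polynomial.aeval_monomial, norm_mul, norm_pow, eq_intCast, Complex.norm_intCast]
          have hm' : (m : ℝ) ≤ R := by exact_mod_cast (Finset.mem_range.1 hm).le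
          calc |(h m : ℝ)| * ‖z‖ ^ (R - m) ≤ |(h m : ℝ)| * 1 := by
                gcongr; exact pow_le_one₀ (norm_nonneg _) hz1
            _ ≤ c * ((m : ℝ) + 1) ^ D := by rw [mul_one]; exact hc m
            _ ≤ _ := by gcongr
      _ = R * (c * ((R : ℝ) + 1) ^ D) := by
          rw [Finset.sum_const, Finset.card_range, nsmul_eq_mul]
      _ ≤ ((R : ℝ) + 1) * ((c + 1) * ((R : ℝ) + 1) ^ D) := by gcongr <;> linarith
      _ = _ := by ring

/-- Positions are kept below the cube of the gap length w, so a bound polynomial in the position is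
polynomial in w and loses against z^w. -/
theorem exists_pow_mul_const_mul_pow_lt_one {z : ℝ} (hz₀ : 0 < z) (hz₁ : z < 1) (c D : ℕ) :
    ∃ w₀ : ℕ, ∀ w ≥ w₀, ∀ N ≤ w ^ 3, z ^ w * (c * ((N : ℝ) + 1) ^ D) < 1 := by
  have h1 := (summable_succ_pow_mul_pow hz₀ hz₁ (3 * D)).tendsto_atTop_zero.const_mul (c : ℝ)
  rw [mul_zero] at h1
  obtain ⟨w₀, hw₀⟩ := Filter.eventually_atTop.1 (h1.eventually_lt_const zero_lt_one)
  refine ⟨w₀, fun w hw N hN => lt_of_le_of_lt ?_ (hw₀ w hw)⟩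
  have e1 : (N : ℝ) + 1 ≤ ((w : ℝ) + 1) ^ 3 := by
    have : (N : ℝ) ≤ (w : ℝ) ^ 3 := by exact_mod_cast hN
    nlinarith [w.cast_nonneg (α := ℝ), sq_nonneg (w : ℝ)]
  calc z ^ w * (c * ((N : ℝ) + 1) ^ D) ≤ z ^ w * (c * (((w : ℝ) + 1) ^ 3) ^ D) := by gcongr
    _ = _ := by rw [← pow_mul]; ring

/-- If the series with digits `lo + A * top` vanishes at `β⁻¹`, then a digit of `top` inside a long
interval without digits of `lo` cannot be preceded by a long interval without any digits. -/
theorem exists_forall_not_gap {β : ℝ} (hβ₁ : 1 < β) (hβ : IsIntegral ℤ β)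
    (hconj : ∀ z ∈ (minpoly ℚ β).aroots ℂ, z ≠ (β : ℂ) → ‖z‖ ≤ 1) {lo top : ℕ → ℤ} {A : ℤ}
    (hA : 0 < A) (Hlo : IsPolyBounded lo) (Htop : IsPolyBounded top) (htop : ∀ n, 0 ≤ top n)
    (h0 : digitTail β⁻¹ (lo + fun n => A * top n) 0 = 0) :
    ∃ w₀ : ℕ, ∀ w ≥ w₀, ∀ R τ : ℕ, R + w ≤ τ → τ + w ≤ w ^ 3 → top τ ≠ 0 →
      (∀ n, R ≤ n → n < τ + w → lo n = 0) → ∃ n, R ≤ n ∧ n < R + w ∧ top n ≠ 0 := by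
  have hz₀ : 0 < β⁻¹ := inv_pos.2 (by linarith)
  have hz₁ : β⁻¹ < 1 := inv_lt_one_of_one_lt₀ hβ₁
  set z := β⁻¹
  have HAtop := Htop.const_mul A
  have H := Hlo.add HAtop
  obtain ⟨c₁, D₁, b₁⟩ := Hlo.abs_digitTail_le hz₀ hz₁
  obtain ⟨c₂, D₂, b₂⟩ := H.abs_digitTail_le hz₀ hz₁
  obtain ⟨c₃, D₃, b₃⟩ := exists_one_le_abs_digitTail_mul hβ₁ hβ hconj H h0
  obtain ⟨w₁, hw₁⟩ := exists_pow_mul_const_mul_pow_lt_one hz₀ hz₁ c₁ D₁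
  obtain ⟨w₂, hw₂⟩ := exists_pow_mul_const_mul_pow_lt_one hz₀ hz₁ (c₂ * c₃) (D₂ + D₃)
  refine ⟨max w₁ w₂, fun w hw R τ hRτ hτ hne hlo => ?_⟩
  by_contra! hno
  -- The digit of `top` at `τ` contributes at least 1, while the digits of `lo` resume only `w`
  -- places later and contribute less than 1 in absolute value.
  have hpos : 0 < digitTail z (lo + fun n => A * top n) τ := by
    rw [digitTail_add Hlo HAtop hz₀ hz₁, digitTail_const_mul,
      digitTail_eq_pow_mul Hlo hz₀ hz₁ (w := w) fun j hj => hlo _ (by omega) (by omega)]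
    have e1 : (1 : ℝ) ≤ digitTail z top τ :=
      le_trans (by exact_mod_cast (htop τ).lt_of_ne' hne)
        (le_digitTail_of_nonneg Htop hz₀ hz₁ htop τ)
    have e2 : (1 : ℝ) ≤ A := by exact_mod_cast hA
    have e3 : -1 < z ^ w * digitTail z lo (τ + w) := by
      have := hw₁ w (le_of_max_le_left hw) _ hτ
      have h4 := (neg_abs_le (digitTail z lo (τ + w))).trans' (neg_le_neg (b₁ (τ + w)))
      have h5 := mul_le_mul_of_nonneg_left h4 (pow_nonneg hz₀.le w)
      linarith
    nlinarith
  -- Between `R` and `τ` only the nonnegative digits of `A * top` occur, so positivity propagates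
  -- back to `R`.
  have hposR : 0 < digitTail z (lo + fun n => A * top n) R := by
    have := pow_mul_digitTail_le H hz₀ hz₁ (R := R) (w := τ - R) fun j hj => by
      rw [Pi.add_apply, hlo _ (by omega) (by omega), zero_add]
      exact mul_nonneg hA.le (htop _)
    rw [Nat.add_sub_cancel' (by omega)] at this
    exact lt_of_lt_of_le (by positivity) this
  -- A run of `w` zeros would make the positive tail at `R` exponentially small in `w`, against the
  -- polynomial lower bound `b₃`.
  have heq := digitTail_eq_pow_mul H hz₀ hz₁ (R := R) (w := w) fun j hj => by
    rw [Pi.add_apply, hlo _ (by omega) (by omega), hno _ (by omega) (by omega)]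
    simp
  have h3 := b₃ R hposR.ne'
  have h4 := b₂ (R + w)
  have h5 := hw₂ w (le_of_max_le_right hw) (R + w) (by omega)
  rw [heq, abs_mul, abs_of_pos (pow_pos hz₀ w)] at h3
  have hR : (R : ℝ) + 1 ≤ ((R + w : ℕ) : ℝ) + 1 := by
    push_cast; linarith [w.cast_nonneg (α := ℝ)]
  have : z ^ w * |digitTail z (lo + fun n => A * top n) (R + w)| * (c₃ * ((R : ℝ) + 1) ^ D₃) ≤
      z ^ w * (((c₂ * c₃ : ℕ) : ℝ) * (((R + w : ℕ) : ℝ) + 1) ^ (D₂ + D₃)) := by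
    calc _ ≤ z ^ w * (c₂ * (((R + w : ℕ) : ℝ) + 1) ^ D₂) *
          (c₃ * (((R + w : ℕ) : ℝ) + 1) ^ D₃) := by gcongr
      _ = _ := by push_cast; ring
  linarith

/-! ### Counting and approximation in sumsets -/

section Counting

theorem ncard_add_inter_Iic_le (A B : Set ℕ) (N : ℕ) :
    ((A + B) ∩ Set.Iic N).ncard ≤ (A ∩ Set.Iic N).ncard * (B ∩ Set.Iic N).ncard := by
  have hsub : (A + B) ∩ Set.Iic N ⊆ (A ∩ Set.Iic N) + (B ∩ Set.Iic N) := by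
    rintro x ⟨⟨a, ha, b, hb, rfl⟩, hx⟩
    have hx : a + b ≤ N := hx
    exact ⟨a, ⟨ha, Set.mem_Iic.2 (by omega)⟩, b, ⟨hb, Set.mem_Iic.2 (by omega)⟩, rfl⟩
  have hA : (A ∩ Set.Iic N).Finite := (Set.finite_Iic N).inter_of_right A
  have hB : (B ∩ Set.Iic N).Finite := (Set.finite_Iic N).inter_of_right B
  refine (Set.ncard_le_ncard hsub (hA.add hB)).trans ?_
  have := Set.natCard_add_le (s := A ∩ Set.Iic N) (t := B ∩ Set.Iic N)
  simpa [Nat.card_coe_set_eq] using this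

theorem ncard_nsmul_inter_Iic_le (A : Set ℕ) (N k : ℕ) :
    ((k • A) ∩ Set.Iic N).ncard ≤ (A ∩ Set.Iic N).ncard ^ k := by
  induction k with
  | zero =>
    rw [zero_nsmul, pow_zero]
    exact (Set.ncard_le_ncard Set.inter_subset_left (Set.finite_singleton 0)).trans
      (by simp)
  | succ k ih =>
    rw [succ_nsmul, pow_succ]
    exact (ncard_add_inter_Iic_le _ _ N).trans (Nat.mul_le_mul_right _ ih)

theorem ncard_nsmul_add_nsmul_le {S T : Set ℕ} {N μ s : ℕ}
    (hS : (S ∩ Set.Iic N).ncard ≤ μ ^ s) (hT : (T ∩ Set.Iic N).ncard ≤ μ) (k l : ℕ) :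
    ((k • S + l • T) ∩ Set.Iic N).ncard ≤ μ ^ (s * k + l) := by
  refine (ncard_add_inter_Iic_le _ _ N).trans ?_
  rw [pow_add, pow_mul]
  exact Nat.mul_le_mul ((ncard_nsmul_inter_Iic_le S N k).trans (Nat.pow_le_pow_left hS k))
    ((ncard_nsmul_inter_Iic_le T N l).trans (Nat.pow_le_pow_left hT l))

/-- A long interval contains a subinterval that avoids a given sparse set. -/
theorem exists_interval_avoiding {D : Set ℕ} {N n : ℕ} (hD : (D ∩ Set.Iic N).ncard ≤ n)
    {x w : ℕ} (hx : x + w * (n + 1) ≤ N) :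
    ∃ y, x ≤ y ∧ y + w ≤ x + w * (n + 1) ∧ ∀ d ∈ D, y ≤ d → y + w ≤ d := by
  by_contra! hno
  have hblock (i : ℕ) (hi : i < n + 1) : x + w * i + w ≤ x + w * (n + 1) := by
    have : w * (i + 1) ≤ w * (n + 1) := Nat.mul_le_mul_left w hi
    linarith
  -- Pigeonhole: otherwise each of n + 1 disjoint blocks of length `w` contains its own element of
  -- `D`.
  have key : ∀ i : Fin (n + 1), ∃ d ∈ D, x + w * i ≤ d ∧ d < x + w * i + w := fun i =>
    hno (x + w * i) (Nat.le_add_right _ _) (hblock i i.2)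
  choose d hdD hd1 hd2 using key
  have hinj : Function.Injective d := by
    intro i j hij
    by_contra hne
    have main (i j : Fin (n + 1)) (hlt : i < j) (hij : d i = d j) : False := by
      have h1 : w * ((i : ℕ) + 1) ≤ w * j := Nat.mul_le_mul_left w hlt
      have h2 := hd2 i
      have h3 := hd1 j
      rw [mul_add, mul_one] at h1
      omega
    rcases lt_or_gt_of_ne hne with h | h
    · exact main i j h hij
    · exact main j i h hij.symm
  have hsub : Set.range d ⊆ D ∩ Set.Iic N := by
    rintro _ ⟨i, rfl⟩
    refine ⟨hdD i, Set.mem_Iic.2 ?_⟩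
    have := hblock i i.2
    have := hd2 i
    omega
  have h1 := Set.ncard_le_ncard hsub ((Set.finite_Iic N).inter_of_right D)
  rw [← Set.image_univ, Set.ncard_image_of_injective _ hinj, Set.ncard_univ, Nat.card_eq_fintype_card,
    Fintype.card_fin] at h1
  omega

/-- Greedy approximation by sums of `k` elements of `S`. -/
theorem exists_mem_nsmul_approx {S : Set ℕ} (h0 : 0 ∈ S) {N μ q Q : ℕ}
    (hstep : ∀ x ≤ N, N ≤ x * μ ^ Q → ∃ s ∈ S, s ≤ x ∧ (x - s) * μ ^ q ≤ x) (hμ : 1 ≤ μ)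
    (k : ℕ) (hk : q * k ≤ Q) {x : ℕ} (hx : x ≤ N) :
    ∃ σ ∈ k • S, σ ≤ x ∧ (x - σ) * μ ^ (q * k) ≤ N := by
  induction k with
  | zero => exact ⟨0, by simp, Nat.zero_le _, by simpa using hx⟩
  | succ k ih =>
    rw [mul_add, mul_one] at hk
    obtain ⟨σ, hσ, hσx, h⟩ := ih (by omega)
    rw [succ_nsmul]
    by_cases hc : N ≤ (x - σ) * μ ^ Q
    · obtain ⟨s, hs, hsx, hs'⟩ := hstep (x - σ) (by omega) hc
      refine ⟨σ + s, Set.add_mem_add hσ hs, by omega, ?_⟩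
      rw [← Nat.sub_sub, mul_add, mul_one, pow_add, mul_comm (μ ^ (q * k)), ← mul_assoc]
      exact (Nat.mul_le_mul_right _ hs').trans h
    -- The remainder is already below N / μ^Q, where `hstep` is not available; 0 ∈ S serves as a
    -- dummy summand.
    · refine ⟨σ + 0, Set.add_mem_add hσ h0, by omega, ?_⟩
      rw [add_zero, mul_add, mul_one]
      exact (Nat.mul_le_mul_left _ (Nat.pow_le_pow_right hμ hk)).trans (by omega)

end Counting

/-! ### Construction of an isolated sum -/

/-- For sparse sets `S` and `T`, with `T` much sparser than `S`, some element of
`(K + 1) • S + (L + 1) • T` is isolated from the sumsets of lower order, and preceded by a long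
interval free of sums. -/
theorem exists_isolated_sum {S T : Set ℕ} (hS0 : 0 ∈ S) (hT0 : 0 ∈ T)
    (hT : ∃ C x₀ : ℕ, ∀ x ≥ x₀, ∃ t ∈ T, t ≤ x ∧ x ≤ C * t)
    (hST : ∀ q Q Z : ℕ, ∃ N μ : ℕ, Z ≤ μ ∧ μ ^ Q ≤ N ∧ (S ∩ Set.Iic N).ncard ≤ μ ^ (q + 3) ∧
      (T ∩ Set.Iic N).ncard ≤ μ ∧
      ∀ x ≤ N, N ≤ x * μ ^ Q → ∃ s ∈ S, s ≤ x ∧ (x - s) * μ ^ q ≤ x)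
    (K L M w₀ : ℕ) :
    ∃ w ≥ w₀, ∃ R τ : ℕ, R + w ≤ τ ∧ τ + w ≤ w ^ 3 ∧ τ ∈ (K + 1) • S + (L + 1) • T ∧
      (∀ n, R ≤ n → n < τ + w → n ∉ K • S + M • T ∧ n ∉ (K + 1) • S + L • T) ∧
      ∀ n, R ≤ n → n < R + w → n ∉ (K + 1) • S + (L + 1) • T := by
  classical
  obtain ⟨C, x₀, hT⟩ := hT
  -- Chosen so that q(K + 1) = n₁ + 3: approximation by K + 1 elements of S is then finer than the
  -- gaps, of order N / μ^n₁, of `K • S + M • T`, which has at most μ^n₁ elements up to N.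
  set q := 3 * K + M + 3 with hq
  set n₁ := (q + 3) * K + M with hn₁
  set n₂ := (q + 3) * (K + 1) + L with hn₂
  set n₃ := (q + 3) * (K + 1) + (L + 1) with hn₃
  set Q₀ := n₁ + n₂ + n₃ + 6 with hQ₀
  obtain ⟨N, μ, hμ, hN, cS, cT, hstep⟩ := hST q (2 * Q₀) (w₀ + x₀ + C + 3)
  have hexp : q * (K + 1) = n₁ + 3 := by rw [hn₁, hq]; ring
  have hexp2 : q * (K + 1) ≤ 2 * Q₀ := by omega
  have hμ1 : 1 ≤ μ := by omega
  have hp (k : ℕ) : 1 ≤ μ ^ k := Nat.one_le_pow _ _ hμ1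
  -- Since N ≥ μ^(2Q₀), this w is at least μ^Q₀; hence N < (w + 1)w and so N ≤ w³.
  set w := N / μ ^ Q₀ with hw
  have hwμ : μ ^ Q₀ ≤ w := by
    rw [hw, Nat.le_div_iff_mul_le (hp Q₀), ← pow_add, ← two_mul]
    exact hN
  have hμw : μ ≤ w := (Nat.le_self_pow (by omega) μ).trans hwμ
  have hwN : w * μ ^ Q₀ ≤ N := Nat.div_mul_le_self _ _
  have hNw : N < (w + 1) * μ ^ Q₀ := by
    rw [mul_comm]; exact Nat.lt_mul_div_succ N (hp Q₀)
  have hNw3 : N ≤ w ^ 3 := by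
    have : N < (w + 1) * w := hNw.trans_le (Nat.mul_le_mul_left _ hwμ)
    have h3 : 3 ≤ w := by omega
    nlinarith [Nat.mul_le_mul_right (w * w) h3, Nat.mul_le_mul_right w h3]
  -- Nested lengths w ≤ X ≤ w₂ ≤ W, each with room for the blocks of one pigeonhole argument. The
  -- exponents add up so that W μ μ^(n₁+1) = w μ^Q₀ ≤ N.
  set X := w * μ ^ (n₃ + 2) with hX
  set w₂ := X * μ with hw₂
  set W := w₂ * μ ^ (n₂ + 1) with hW
  have hXw : w ≤ X := Nat.le_mul_of_pos_right _ (hp _)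
  have hXw₂ : X + w ≤ w₂ := by
    have := Nat.mul_le_mul_left X (by omega : 3 ≤ μ)
    omega
  have hw₂pos : 0 < w₂ := by omega
  have c₁ := ncard_nsmul_add_nsmul_le cS cT K M
  have c₂ := ncard_nsmul_add_nsmul_le cS cT (K + 1) L
  have c₃ := ncard_nsmul_add_nsmul_le cS cT (K + 1) (L + 1)
  rw [← hn₁] at c₁
  rw [← hn₂] at c₂
  rw [← hn₃] at c₃
  have hsucc (k : ℕ) : μ ^ k + 2 ≤ μ ^ (k + 1) := by
    rw [pow_succ]
    have := Nat.mul_le_mul_left (μ ^ k) (by omega : 3 ≤ μ)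
    have := hp k
    omega
  have hWfit : W * μ * (μ ^ n₁ + 1) ≤ N := by
    refine le_trans ?_ hwN
    calc W * μ * (μ ^ n₁ + 1) ≤ W * μ * μ ^ (n₁ + 1) :=
          Nat.mul_le_mul_left _ (by have := hsucc n₁; omega)
      _ = w * μ ^ Q₀ := by rw [hW, hw₂, hX, hQ₀]; ring
  obtain ⟨y, -, hy, hy'⟩ := exists_interval_avoiding c₁ (x := 0) (by rwa [zero_add])
  rw [zero_add] at hy
  have hWμ : 3 * W ≤ W * μ := by rw [mul_comm]; exact Nat.mul_le_mul_left _ (by omega)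
  have hyN : y + W * μ ≤ N := hy.trans hWfit
  obtain ⟨σ, hσ, hσx, hσ'⟩ := exists_mem_nsmul_approx hS0 hstep hμ1 (K + 1) hexp2
    (x := y + W) (by omega)
  have hyσ : y ≤ σ := by
    by_contra! hlt
    have h1 : W * μ ^ (q * (K + 1)) ≤ N := le_trans (Nat.mul_le_mul_right _ (by omega)) hσ'
    have h2 : W * μ ^ (q * (K + 1)) = w * μ * μ ^ Q₀ := by
      rw [hexp, hW, hw₂, hX, hQ₀]; ring
    have h3 : (w + 1) * μ ^ Q₀ ≤ w * μ * μ ^ Q₀ := by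
      refine Nat.mul_le_mul_right _ ?_
      have := Nat.mul_le_mul_left w (by omega : 3 ≤ μ)
      omega
    omega
  have hσD : σ ∈ (K + 1) • S + L • T :=
    ⟨σ, hσ, 0, Set.zero_mem_nsmul hT0, add_zero σ⟩
  have hfit₂ : w₂ * (μ ^ n₂ + 1) ≤ W := Nat.mul_le_mul_left _ (by have := hsucc n₂; omega)
  obtain ⟨y₂, hy₂, hy₂W, hy₂'⟩ := exists_interval_avoiding c₂ (x := y + W) (w := w₂) (by omega)
  have hσy₂ : σ < y₂ := by
    by_contra! hle
    have := hy₂' σ hσD hle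
    omega
  -- The last sum before the gap at `y₂`: no element of `(K + 1) • S + L • T` lies strictly between
  -- `R₁` and `y₂ + w₂`. As `R₁ ≥ σ ≥ y`, it also lies in the gap of `K • S + M • T`.
  set R₁ := Nat.findGreatest (· ∈ (K + 1) • S + L • T) y₂ with hR₁
  have hR₁D : R₁ ∈ (K + 1) • S + L • T := Nat.findGreatest_spec hσy₂.le hσD
  have hσR₁ : σ ≤ R₁ := Nat.le_findGreatest hσy₂.le hσD
  have hR₁y₂ : R₁ < y₂ := by
    by_contra! hle
    have := hy₂' R₁ hR₁D hle
    have : R₁ ≤ y₂ := Nat.findGreatest_le y₂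
    omega
  -- The point `R₁ + t` stays inside both gaps because t ≤ X, and t ≥ X / C leaves room after `R₁`
  -- for a gap of `(K + 1) • S + (L + 1) • T`.
  obtain ⟨t, htT, htX, hCt⟩ := hT X (by omega)
  have htw : w * (μ ^ n₃ + 1) + 1 ≤ t := by
    have h1 : w * μ ^ (n₃ + 1) ≤ t := by
      refine Nat.le_of_mul_le_mul_right (c := μ) ?_ hμ1
      calc w * μ ^ (n₃ + 1) * μ = X := by rw [hX]; ring
        _ ≤ C * t := hCt
        _ ≤ t * μ := by rw [mul_comm]; exact Nat.mul_le_mul_left _ (by omega)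
    have h2 := Nat.mul_le_mul_left w (hsucc n₃)
    have h3 : w * (μ ^ n₃ + 2) = w * (μ ^ n₃ + 1) + w := by ring
    omega
  obtain ⟨R, hR, hRw, hR'⟩ := exists_interval_avoiding c₃ (x := R₁ + 1) (w := w) (by omega)
  refine ⟨w, by omega, R, R₁ + t, by omega, by omega, ?_, ?_, ?_⟩
  · rw [succ_nsmul T, ← add_assoc]
    exact Set.add_mem_add hR₁D htT
  · intro n hRn hnτ
    refine ⟨fun hn => ?_, fun hn => ?_⟩
    · have := hy' n hn (by omega)
      omega
    · rcases le_or_gt n y₂ with h | h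
      · have : n ≤ R₁ := Nat.le_findGreatest h hn
        omega
      · have := hy₂' n hn h.le
        omega
  · intro n hRn hnw hn
    have := hR' n hn hRn
    omega

/-! ### Algebraic independence for sparse digit sets -/

open Classical in
/-- The power series with exponent set `S` and all coefficients equal to `1`. -/
noncomputable def indicatorSeries (S : Set ℕ) : PowerSeries ℕ :=
  PowerSeries.mk fun n => if n ∈ S then 1 else 0

theorem coeffSupport_indicatorSeries (S : Set ℕ) : coeffSupport (indicatorSeries S) = S := by
  ext n
  simp [coeffSupport, indicatorSeries]

theorem isPolyBounded_indicatorSeries (S : Set ℕ) :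
    IsPolyBounded (coeffSeq (indicatorSeries S)) := by
  refine ⟨1, 0, fun n => ?_⟩
  simp only [coeffSeq, indicatorSeries, PowerSeries.coeff_mk]
  split_ifs <;> simp

/-- The real number with digits `1` exactly at the positions in `S`. -/
noncomputable def sparseSum (z : ℝ) (S : Set ℕ) : ℝ :=
  digitTail z (coeffSeq (indicatorSeries S)) 0

theorem coeffSeq_ne_zero_iff {S T : Set ℕ} {k l n : ℕ} :
    coeffSeq (indicatorSeries S ^ k * indicatorSeries T ^ l) n ≠ 0 ↔ n ∈ k • S + l • T := by
  rw [← coeffSupport_indicatorSeries S, ← coeffSupport_indicatorSeries T, ← coeffSupport_pow,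
    ← coeffSupport_pow, ← coeffSupport_mul, coeffSupport_indicatorSeries,
    coeffSupport_indicatorSeries]
  simp [coeffSeq, coeffSupport]

theorem isPolyBounded_monomial (S T : Set ℕ) (k l : ℕ) :
    IsPolyBounded (coeffSeq (indicatorSeries S ^ k * indicatorSeries T ^ l)) :=
  ((isPolyBounded_indicatorSeries S).coeffSeq_pow k).coeffSeq_mul
    ((isPolyBounded_indicatorSeries T).coeffSeq_pow l)

theorem digitTail_monomial {z : ℝ} (hz₀ : 0 < z) (hz₁ : z < 1) (S T : Set ℕ) (k l : ℕ) :
    digitTail z (coeffSeq (indicatorSeries S ^ k * indicatorSeries T ^ l)) 0 =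
      sparseSum z S ^ k * sparseSum z T ^ l := by
  rw [digitTail_coeffSeq_mul hz₀ hz₁ ((isPolyBounded_indicatorSeries S).coeffSeq_pow k)
    ((isPolyBounded_indicatorSeries T).coeffSeq_pow l),
    digitTail_coeffSeq_pow hz₀ hz₁ (isPolyBounded_indicatorSeries S),
    digitTail_coeffSeq_pow hz₀ hz₁ (isPolyBounded_indicatorSeries T)]
  rfl

theorem aeval_ne_zero_of_sparse {β : ℝ} (hβ₁ : 1 < β) (hβ : IsIntegral ℤ β)
    (hconj : ∀ z ∈ (minpoly ℚ β).aroots ℂ, z ≠ (β : ℂ) → ‖z‖ ≤ 1)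
    {S T : Set ℕ} (hS0 : 0 ∈ S) (hT0 : 0 ∈ T)
    (hT : ∃ C x₀ : ℕ, ∀ x ≥ x₀, ∃ t ∈ T, t ≤ x ∧ x ≤ C * t)
    (hST : ∀ q Q Z : ℕ, ∃ N μ : ℕ, Z ≤ μ ∧ μ ^ Q ≤ N ∧ (S ∩ Set.Iic N).ncard ≤ μ ^ (q + 3) ∧
      (T ∩ Set.Iic N).ncard ≤ μ ∧
      ∀ x ≤ N, N ≤ x * μ ^ Q → ∃ s ∈ S, s ≤ x ∧ (x - s) * μ ^ q ≤ x)
    (P : MvPolynomial (Fin 2) ℤ) {d₀ : Fin 2 →₀ ℕ} (hd₀ : 0 < P.coeff d₀)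
    (hmax : ∀ d ∈ P.support, toLex (d 0, d 1) ≤ toLex (d₀ 0, d₀ 1)) :
    MvPolynomial.aeval ![sparseSum β⁻¹ S, sparseSum β⁻¹ T] P ≠ 0 := by
  intro hP
  have hz₀ : 0 < β⁻¹ := inv_pos.2 (by linarith)
  have hz₁ : β⁻¹ < 1 := inv_lt_one_of_one_lt₀ hβ₁
  set z := β⁻¹
  -- The shift by 1 is the multiplication of P by both variables: the leading monomial then contains
  -- at least one summand from S and one from T.
  let F (d : Fin 2 →₀ ℕ) : ℕ → ℤ :=
    coeffSeq (indicatorSeries S ^ (d 0 + 1) * indicatorSeries T ^ (d 1 + 1))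
  have hF (d) : IsPolyBounded (F d) := isPolyBounded_monomial S T _ _
  let G (d : Fin 2 →₀ ℕ) : ℕ → ℤ := fun n => P.coeff d * F d n
  have hG (d) : IsPolyBounded (G d) := (hF d).const_mul _
  let lo : ℕ → ℤ := ∑ d ∈ P.support.erase d₀, G d
  have hlo : IsPolyBounded lo := IsPolyBounded.sum _ fun d _ => hG d
  have hd₀mem : d₀ ∈ P.support := MvPolynomial.mem_support_iff.2 hd₀.ne'
  have hsum : lo + G d₀ = ∑ d ∈ P.support, G d := Finset.sum_erase_add _ _ hd₀mem
  have h0 : digitTail z (lo + fun n => P.coeff d₀ * F d₀ n) 0 = 0 := by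
    change digitTail z (lo + G d₀) 0 = 0
    rw [hsum, digitTail_sum _ (fun d _ => hG d) hz₀ hz₁]
    have hterm (d) : digitTail z (G d) 0 = sparseSum z S * sparseSum z T *
        (P.coeff d * (sparseSum z S ^ d 0 * sparseSum z T ^ d 1)) := by
      rw [digitTail_const_mul, digitTail_monomial hz₀ hz₁]
      ring
    rw [Finset.sum_congr rfl fun d _ => hterm d, ← Finset.mul_sum]
    rw [MvPolynomial.aeval_def, MvPolynomial.eval₂_eq'] at hP
    simp only [Fin.prod_univ_two, Matrix.cons_val_zero, Matrix.cons_val_one, eq_intCast] at hP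
    rw [hP, mul_zero]
  obtain ⟨w₀, hw₀⟩ := exists_forall_not_gap hβ₁ hβ hconj hd₀ hlo (hF d₀)
    (fun n => coeffSeq_nonneg _ n) h0
  let M := P.support.sup (fun d => d 1) + 1
  obtain ⟨w, hw, R, τ, hRτ, hτw, hτ, hlow, htop⟩ :=
    exists_isolated_sum hS0 hT0 hT hST (d₀ 0) (d₀ 1) M w₀
  obtain ⟨n, hn₁, hn₂, hn₃⟩ := hw₀ w hw R τ hRτ hτw (coeffSeq_ne_zero_iff.2 hτ) fun n hn₁ hn₂ => by
    obtain ⟨hA, hB⟩ := hlow n hn₁ hn₂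
    change (∑ d ∈ P.support.erase d₀, G d) n = 0
    rw [Finset.sum_apply]
    refine Finset.sum_eq_zero fun d hd => ?_
    obtain ⟨hne, hd⟩ := Finset.mem_erase.1 hd
    by_contra hGd
    have hmem := coeffSeq_ne_zero_iff.1 (right_ne_zero_of_mul hGd)
    have hM : d 1 + 1 ≤ M := Nat.succ_le_succ (Finset.le_sup (f := fun d => d 1) hd)
    -- A lexicographically smaller monomial has a smaller S-exponent, or the same one and a smaller
    -- T-exponent. As 0 lies in S and T, its sumset is contained in one of the two excluded sumsets.
    rcases Prod.Lex.le_iff.1 (hmax d hd) with h | ⟨h, h'⟩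
    · exact hA (Set.add_subset_add (Set.nsmul_subset_nsmul_right hS0 h)
        (Set.nsmul_subset_nsmul_right hT0 hM) hmem)
    · have h : d 0 = d₀ 0 := h
      have h' : d 1 ≤ d₀ 1 := h'
      rcases h'.eq_or_lt with h' | h'
      · refine hne (Finsupp.ext fun i => ?_)
        fin_cases i
        · exact h
        · exact h'
      · exact hB (Set.add_subset_add (Set.nsmul_subset_nsmul_right hS0 (by omega))
          (Set.nsmul_subset_nsmul_right hT0 h') hmem)
  exact htop n hn₁ hn₂ (coeffSeq_ne_zero_iff.1 hn₃)

theorem algebraicIndependent_sparseSum {β : ℝ} (hβ₁ : 1 < β) (hβ : IsIntegral ℤ β)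
    (hconj : ∀ z ∈ (minpoly ℚ β).aroots ℂ, z ≠ (β : ℂ) → ‖z‖ ≤ 1)
    {S T : Set ℕ} (hS0 : 0 ∈ S) (hT0 : 0 ∈ T)
    (hT : ∃ C x₀ : ℕ, ∀ x ≥ x₀, ∃ t ∈ T, t ≤ x ∧ x ≤ C * t)
    (hST : ∀ q Q Z : ℕ, ∃ N μ : ℕ, Z ≤ μ ∧ μ ^ Q ≤ N ∧ (S ∩ Set.Iic N).ncard ≤ μ ^ (q + 3) ∧
      (T ∩ Set.Iic N).ncard ≤ μ ∧
      ∀ x ≤ N, N ≤ x * μ ^ Q → ∃ s ∈ S, s ≤ x ∧ (x - s) * μ ^ q ≤ x) :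
    AlgebraicIndependent ℤ ![sparseSum β⁻¹ S, sparseSum β⁻¹ T] := by
  rw [algebraicIndependent_iff]
  intro P hP
  by_contra hP0
  obtain ⟨d₀, hd₀, hmax⟩ := Finset.exists_max_image P.support (fun d => toLex (d 0, d 1))
    (Finset.nonempty_iff_ne_empty.2 fun h => hP0 (MvPolynomial.support_eq_empty.1 h))
  -- Replacing P by -P makes the leading coefficient positive.
  rcases lt_or_gt_of_ne (MvPolynomial.mem_support_iff.1 hd₀) with h | h
  · refine aeval_ne_zero_of_sparse hβ₁ hβ hconj hS0 hT0 hT hST (-P) (d₀ := d₀) ?_ ?_ ?_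
    · rw [MvPolynomial.coeff_neg]; exact neg_pos.2 h
    · rwa [MvPolynomial.support_neg]
    · rw [map_neg, hP, neg_zero]
  · exact aeval_ne_zero_of_sparse hβ₁ hβ hconj hS0 hT0 hT hST P h hmax hP

/-- Algebraic independence is not affected by adding algebraic numbers. -/
theorem AlgebraicIndependent.add_isAlgebraic {ι : Type*} {x c : ι → ℝ}
    (hx : AlgebraicIndependent ℤ x) (hc : ∀ i, IsAlgebraic ℚ (c i)) :
    AlgebraicIndependent ℚ (x + c) := by
  have : Algebra.IsAlgebraic ℤ ℚ := IsLocalization.isAlgebraic ℚ (nonZeroDivisors ℤ)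
  have hx' : AlgebraicIndependent (algebraicClosure ℚ ℝ) x := (hx.extendScalars ℚ).algebraicClosure
  let e (i : ι) : algebraicClosure ℚ ℝ := ⟨c i, (hc i).isIntegral⟩
  have h1 := hx'.polynomial_aeval_of_transcendental
    (f := fun i => Polynomial.X + Polynomial.C (e i)) fun i => by
      refine Polynomial.transcendental _ ?_ ?_
      · rw [Polynomial.natDegree_X_add_C]
        exact one_ne_zero
      · rw [Polynomial.leadingCoeff_X_add_C]
        exact one_mem _
  have h2 : (fun i => Polynomial.aeval (x i) (Polynomial.X + Polynomial.C (e i))) = x + c := by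
    funext i
    simp only [map_add, Polynomial.aeval_X, Polynomial.aeval_C, Pi.add_apply]
    rfl
  rw [h2] at h1
  exact h1.restrictScalars (algebraMap ℚ (algebraicClosure ℚ ℝ)).injective

/-! ### Digit sets formed by integer parts -/

theorem le_sub_of_strictMonoOn {φ : ℕ → ℤ} {k : ℕ} (hφ : StrictMonoOn φ (Set.Ici k)) (j : ℕ) :
    φ k + j ≤ φ (k + j) := by
  induction j with
  | zero => simp
  | succ j ih =>
    have : φ (k + j) < φ (k + (j + 1)) :=
      hφ (Set.mem_Ici.2 (by omega)) (Set.mem_Ici.2 (by omega)) (by omega)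
    push_cast
    omega

theorem exists_le_lt_succ {φ : ℕ → ℤ} {k : ℕ} (hφ : StrictMonoOn φ (Set.Ici k)) {x : ℤ}
    (hx : φ k ≤ x) : ∃ m ≥ k, φ m ≤ x ∧ x < φ (m + 1) := by
  by_contra! hno
  have hall (j : ℕ) : φ (k + j) ≤ x := by
    induction j with
    | zero => exact hx
    | succ j ih => exact hno (k + j) (by omega) ih
  have h1 := hall ((x - φ k).toNat + 1)
  have h2 := le_sub_of_strictMonoOn hφ ((x - φ k).toNat + 1)
  push_cast at h2
  omega

/-- A strictly increasing integer sequence gains at least 1 at each step, so `a` is unbounded on the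
integers; monotonicity extends this to real arguments. -/
theorem tendsto_atTop_of_ultimatelyIncreasing_floor {a : ℝ → ℝ} (ha : UltimatelyIncreasing a)
    (hfl : UltimatelyIncreasing fun m : ℕ => ⌊a (m : ℝ)⌋) :
    Filter.Tendsto a Filter.atTop Filter.atTop := by
  obtain ⟨x₀, ha⟩ := ha
  obtain ⟨k, hfl⟩ := hfl
  refine Filter.tendsto_atTop.2 fun B => ?_
  have hbig : ∃ m : ℕ, x₀ ≤ m ∧ B ≤ a m := by
    refine ⟨k + (⌈x₀⌉₊ + (⌈B⌉ - ⌊a (k : ℝ)⌋).toNat), ?_, ?_⟩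
    · have := Nat.le_ceil x₀
      push_cast
      have h1 := k.cast_nonneg (α := ℝ)
      have h2 := ((⌈B⌉ - ⌊a (k : ℝ)⌋).toNat).cast_nonneg (α := ℝ)
      linarith
    · have h2 := le_sub_of_strictMonoOn hfl (⌈x₀⌉₊ + (⌈B⌉ - ⌊a (k : ℝ)⌋).toNat)
      refine (Int.le_ceil B).trans (le_trans ?_ (Int.floor_le _))
      rw [Int.cast_le]
      refine le_trans ?_ h2
      push_cast
      omega
  obtain ⟨m, hm, hB⟩ := hbig
  filter_upwards [Filter.eventually_ge_atTop (m : ℝ)] with x hx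
  exact hB.trans (ha.monotoneOn (Set.mem_Ici.2 hm) (Set.mem_Ici.2 (hm.trans hx)) hx)

/-- Zero, and the integer parts of the values `a m` for the integers `m ≥ k`. -/
def floorSet (a : ℝ → ℝ) (k : ℕ) : Set ℕ := insert 0 {n | ∃ m ≥ k, (n : ℤ) = ⌊a (m : ℝ)⌋}

theorem ncard_floorSet_inter_Iic_le {a : ℝ → ℝ} {k N n : ℕ}
    (h : ∀ m ≥ k, ⌊a (m : ℝ)⌋ ≤ N → m < n) : (floorSet a k ∩ Set.Iic N).ncard ≤ n + 1 := by
  have hsub : floorSet a k ∩ Set.Iic N ⊆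
      ((insert 0 ((Finset.range n).image fun m : ℕ => ⌊a (m : ℝ)⌋.toNat) : Finset ℕ) : Set ℕ) := by
    rintro x ⟨rfl | ⟨m, hm, hx⟩, hxN⟩
    · simp
    · have hxN : x ≤ N := hxN
      have hmn := h m hm (by omega)
      refine Finset.mem_coe.2 (Finset.mem_insert_of_mem (Finset.mem_image.2
        ⟨m, Finset.mem_range.2 hmn, ?_⟩))
      omega
  refine (Set.ncard_le_ncard hsub (Finset.finite_toSet _)).trans ?_
  rw [Set.ncard_coe_finset]
  refine (Finset.card_insert_le _ _).trans (Nat.succ_le_succ ?_)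
  exact Finset.card_image_le.trans (by simp)

/-- Up to an algebraic number, the series attached to a sequence is the sum over its digit set. -/
theorem summable_and_tsum_eq {β : ℝ} (hβ₁ : 1 < β) (hβ : IsAlgebraic ℚ β) {a : ℝ → ℝ} {m₀ k : ℕ}
    (hk : m₀ ≤ k) (hmono : StrictMonoOn (fun m : ℕ => ⌊a (m : ℝ)⌋) (Set.Ici k))
    (hpos : 1 ≤ ⌊a (k : ℝ)⌋) :
    Summable (fun n : ℕ => β ^ (-⌊a ((m₀ + n : ℕ) : ℝ)⌋)) ∧
      ∃ c : ℝ, IsAlgebraic ℚ c ∧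
        ∑' n : ℕ, β ^ (-⌊a ((m₀ + n : ℕ) : ℝ)⌋) = sparseSum β⁻¹ (floorSet a k) + c := by
  classical
  have hβ0 : 0 < β := by linarith
  have hz₀ : 0 < β⁻¹ := inv_pos.2 hβ0
  have hz₁ : β⁻¹ < 1 := inv_lt_one_of_one_lt₀ hβ₁
  let σ : ℕ → ℕ := fun j => ⌊a ((k + j : ℕ) : ℝ)⌋.toNat
  have hge (j : ℕ) : 1 ≤ ⌊a ((k + j : ℕ) : ℝ)⌋ := by
    have : ⌊a (k : ℝ)⌋ + j ≤ ⌊a ((k + j : ℕ) : ℝ)⌋ := le_sub_of_strictMonoOn hmono j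
    omega
  have hσ (j : ℕ) : (σ j : ℤ) = ⌊a ((k + j : ℕ) : ℝ)⌋ := Int.toNat_of_nonneg (by linarith [hge j])
  have hσinj : Function.Injective σ := by
    intro i j hij
    have h1 : ⌊a ((k + i : ℕ) : ℝ)⌋ = ⌊a ((k + j : ℕ) : ℝ)⌋ := by rw [← hσ, ← hσ, hij]
    have := hmono.injOn (Set.mem_Ici.2 (by omega)) (Set.mem_Ici.2 (by omega)) h1
    omega
  have hterm (j : ℕ) : β ^ (-⌊a ((k + j : ℕ) : ℝ)⌋) = β⁻¹ ^ σ j := by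
    rw [← hσ, zpow_neg, zpow_natCast, inv_pow]
  have hgeom : Summable fun n : ℕ => β⁻¹ ^ n := summable_geometric_of_lt_one hz₀.le hz₁
  have htail : Summable fun j : ℕ => β ^ (-⌊a ((k + j : ℕ) : ℝ)⌋) :=
    (hgeom.comp_injective hσinj).congr fun j => (hterm j).symm
  have hshift : (fun j : ℕ => β ^ (-⌊a ((m₀ + (j + (k - m₀)) : ℕ) : ℝ)⌋)) =
      fun j : ℕ => β ^ (-⌊a ((k + j : ℕ) : ℝ)⌋) := by
    funext j
    rw [show m₀ + (j + (k - m₀)) = k + j by omega]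
  have hsum : Summable (fun n : ℕ => β ^ (-⌊a ((m₀ + n : ℕ) : ℝ)⌋)) := by
    rw [← summable_nat_add_iff (k - m₀), hshift]
    exact htail
  -- The finitely many terms before `k` are restored, and 1 is subtracted for the artificial digit
  -- at position 0.
  refine ⟨hsum, ∑ n ∈ Finset.range (k - m₀), β ^ (-⌊a ((m₀ + n : ℕ) : ℝ)⌋) - 1, ?_, ?_⟩
  · have hmem : β ∈ algebraicClosure ℚ ℝ := hβ.isIntegral
    have : ∑ n ∈ Finset.range (k - m₀), β ^ (-⌊a ((m₀ + n : ℕ) : ℝ)⌋) - 1 ∈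
        algebraicClosure ℚ ℝ :=
      sub_mem (sum_mem fun n _ => zpow_mem hmem _) (one_mem _)
    exact IsIntegral.isAlgebraic this
  · rw [← hsum.sum_add_tsum_nat_add (k - m₀), hshift]
    have hsplit : HasSum (fun n : ℕ => (coeffSeq (indicatorSeries (floorSet a k)) (0 + n) : ℝ) *
        β⁻¹ ^ n) (1 + ∑' j : ℕ, β ^ (-⌊a ((k + j : ℕ) : ℝ)⌋)) := by
      have h1 : HasSum (fun n : ℕ => if n = 0 then (1 : ℝ) else 0) 1 := hasSum_ite_eq 0 1
      have h2 : HasSum ((Set.range σ).indicator fun n : ℕ => β⁻¹ ^ n)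
          (∑' j : ℕ, β ^ (-⌊a ((k + j : ℕ) : ℝ)⌋)) := by
        refine (hσinj.hasSum_iff fun n hn => Set.indicator_of_notMem hn _).1 ?_
        have hfun : ((Set.range σ).indicator fun n : ℕ => β⁻¹ ^ n) ∘ σ =
            fun j : ℕ => β ^ (-⌊a ((k + j : ℕ) : ℝ)⌋) := by
          funext j
          rw [Function.comp_apply, Set.indicator_of_mem (Set.mem_range_self j), hterm]
        rw [hfun]
        exact htail.hasSum
      have hfun : (fun n : ℕ => (coeffSeq (indicatorSeries (floorSet a k)) (0 + n) : ℝ) *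
          β⁻¹ ^ n) = fun n : ℕ => (if n = 0 then (1 : ℝ) else 0) +
            (Set.range σ).indicator (fun n : ℕ => β⁻¹ ^ n) n := by
        funext n
        have hrange : n ∈ Set.range σ ↔ ∃ m ≥ k, (n : ℤ) = ⌊a (m : ℝ)⌋ := by
          constructor
          · rintro ⟨j, rfl⟩
            exact ⟨k + j, by omega, hσ j⟩
          · rintro ⟨m, hm, hn⟩
            refine ⟨m - k, ?_⟩
            have := hσ (m - k)
            rw [Nat.add_sub_cancel' hm] at this
            omega
        have hrange0 : 0 ∉ Set.range σ := by
          rintro ⟨j, hj⟩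
          have h1 := hσ j
          have h2 := hge j
          omega
        simp only [coeffSeq, indicatorSeries, PowerSeries.coeff_mk, zero_add, floorSet,
          Set.mem_insert_iff, Set.mem_ofPred_eq, ← hrange, Set.indicator_apply]
        by_cases h0 : n = 0
        · subst h0
          simp [hrange0]
        · by_cases hn : n ∈ Set.range σ <;> simp [h0, hn]
      rw [hfun]
      exact h1.add h2
    rw [sparseSum, digitTail, hsplit.tsum_eq]
    ring

theorem exists_mem_floorSet_le_mul {u : ℝ → ℝ} {k : ℕ}
    (hmono : StrictMonoOn (fun m : ℕ => ⌊u (m : ℝ)⌋) (Set.Ici k)) (hpos : 1 ≤ ⌊u (k : ℝ)⌋)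
    {C : ℝ} (hC : 0 < C) (hratio : ∀ m : ℕ, k ≤ m → u ((m : ℝ) + 1) / u m < C) :
    ∃ C x₀ : ℕ, ∀ x ≥ x₀, ∃ t ∈ floorSet u k, t ≤ x ∧ x ≤ C * t := by
  -- The factor 2 absorbs the rounding: u(m) < t + 1 ≤ 2t.
  refine ⟨⌈C⌉₊ * 2, ⌊u (k : ℝ)⌋.toNat, fun x hx => ?_⟩
  obtain ⟨m, hm, h1, h2⟩ := exists_le_lt_succ hmono (x := (x : ℤ)) (by omega)
  have h3 : 1 ≤ ⌊u (m : ℝ)⌋ := hpos.trans (hmono.monotoneOn (Set.mem_Ici.2 le_rfl) hm hm)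
  have ht : ((⌊u (m : ℝ)⌋.toNat : ℕ) : ℤ) = ⌊u (m : ℝ)⌋ := Int.toNat_of_nonneg (by omega)
  refine ⟨⌊u (m : ℝ)⌋.toNat, Or.inr ⟨m, hm, ht⟩, by omega, ?_⟩
  set t := ⌊u (m : ℝ)⌋.toNat
  have hut : u m < t + 1 := by
    have := Int.lt_floor_add_one (u (m : ℝ))
    rw [← ht] at this
    exact_mod_cast this
  have hum : 1 ≤ u m := by
    have := Int.floor_le (u (m : ℝ))
    have h4 : (1 : ℝ) ≤ (⌊u (m : ℝ)⌋ : ℝ) := by exact_mod_cast h3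
    linarith
  have hxu : (x : ℝ) ≤ u ((m : ℝ) + 1) := by
    have := Int.floor_le (u ((m + 1 : ℕ) : ℝ))
    have h4 : (x : ℝ) ≤ (⌊u ((m + 1 : ℕ) : ℝ)⌋ : ℝ) := by exact_mod_cast h2.le
    rw [← Nat.cast_succ]
    exact h4.trans this
  have h5 := (div_lt_iff₀ (by linarith)).1 (hratio m hm)
  have ht1 : (1 : ℝ) ≤ t := by
    have : 1 ≤ t := by omega
    exact_mod_cast this
  have h6 : (x : ℝ) ≤ (⌈C⌉₊ * 2 : ℕ) * t := by
    have h7 := Nat.le_ceil C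
    push_cast
    calc (x : ℝ) ≤ C * u m := by linarith
      _ ≤ ⌈C⌉₊ * (2 * t) := mul_le_mul h7 (by linarith) (by linarith) (by positivity)
      _ = _ := by ring
  exact_mod_cast h6

/-! ### Scales from the growth conditions -/

theorem eventually_pow_le_of_log_div_log {a : ℝ → ℝ}
    (ha : Filter.Tendsto a Filter.atTop Filter.atTop)
    (hlim : Filter.Tendsto (fun R : ℝ => Real.log (a R) / Real.log R) Filter.atTop Filter.atTop)
    (k : ℕ) : ∀ᶠ x in Filter.atTop, x ^ k ≤ a x := by
  filter_upwards [ha.eventually_gt_atTop 0, hlim.eventually_ge_atTop (k : ℝ),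
    Filter.eventually_gt_atTop (1 : ℝ)] with x h1 h2 h3
  have h4 := (le_div_iff₀ (Real.log_pos h3)).1 h2
  rw [← Real.log_pow] at h4
  exact (Real.log_le_log_iff (by positivity) h1).1 h4

/-- An upper bound for the ratio of consecutive values, from a bound for the logarithmic
derivative. -/
theorem sub_le_of_deriv_log_lt {a : ℝ → ℝ} {x δ : ℝ}
    (hdiff : ∀ y ∈ Set.Icc x (x + 1), DifferentiableAt ℝ a y)
    (hpos : ∀ y ∈ Set.Icc x (x + 1), 0 < a y)
    (hder : ∀ y ∈ Set.Ioo x (x + 1), deriv (fun t => Real.log (a t)) y ≤ δ) (hδ : δ ≤ 1)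
    (hδ0 : 0 ≤ δ) : a (x + 1) - a x ≤ 2 * δ * a x := by
  have hd : ∀ y ∈ Set.Icc x (x + 1), DifferentiableAt ℝ (fun t => Real.log (a t)) y :=
    fun y hy => (hdiff y hy).log (hpos y hy).ne'
  obtain ⟨ξ, hξ, h⟩ := exists_deriv_eq_slope (fun t => Real.log (a t)) (lt_add_one x)
    (fun y hy => (hd y hy).continuousAt.continuousWithinAt)
    (fun y hy => (hd y (Set.Ioo_subset_Icc_self hy)).differentiableWithinAt)
  rw [add_sub_cancel_left, div_one] at h
  have hx := hpos x (Set.left_mem_Icc.2 (by linarith))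
  have hx1 := hpos (x + 1) (Set.right_mem_Icc.2 (by linarith))
  have h1 : Real.log (a (x + 1) / a x) ≤ δ := by
    rw [Real.log_div hx1.ne' hx.ne', ← h]
    exact hder ξ hξ
  have h2 : a (x + 1) / a x ≤ Real.exp δ := (Real.log_le_iff_le_exp (by positivity)).1 h1
  have h3 : Real.exp δ ≤ 1 + 2 * δ := by
    have := Real.abs_exp_sub_one_le (x := δ) (by rwa [abs_of_nonneg hδ0])
    rw [abs_of_nonneg hδ0] at this
    linarith [le_abs_self (Real.exp δ - 1)]
  have h4 := (div_le_iff₀ hx).1 (h2.trans h3)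
  linarith

/-- The exponent -1 + 1/(2(q+1)) turns μ^(q+1) into μ^(-q-1/2), which beats μ^q by a factor √μ ≥ 8.
-/
theorem rpow_mul_pow_le {μ q : ℕ} {x : ℝ} (hμ : 64 ≤ μ) (hx : (μ : ℝ) ^ (q + 1) ≤ x) :
    x ^ (-1 + 1 / (2 * ((q : ℝ) + 1))) * (μ : ℝ) ^ q ≤ 1 / 8 := by
  have hμ0 : (0 : ℝ) < μ := by exact_mod_cast (by omega : 0 < μ)
  have hq : (0 : ℝ) < (q : ℝ) + 1 := by positivity
  have hneg : -1 + 1 / (2 * ((q : ℝ) + 1)) ≤ 0 := by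
    have : 1 / (2 * ((q : ℝ) + 1)) ≤ 1 := by
      rw [div_le_one (by positivity)]
      linarith [q.cast_nonneg (α := ℝ)]
    linarith
  have h1 : x ^ (-1 + 1 / (2 * ((q : ℝ) + 1))) ≤
      ((μ : ℝ) ^ (q + 1)) ^ (-1 + 1 / (2 * ((q : ℝ) + 1))) :=
    Real.rpow_le_rpow_of_nonpos (by positivity) hx hneg
  have h2 : ((μ : ℝ) ^ (q + 1)) ^ (-1 + 1 / (2 * ((q : ℝ) + 1))) * (μ : ℝ) ^ q =
      (μ : ℝ) ^ (-(1 / 2) : ℝ) := by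
    rw [← Real.rpow_natCast, ← Real.rpow_natCast, ← Real.rpow_mul hμ0.le, ← Real.rpow_add hμ0]
    congr 1
    push_cast
    field_simp
    ring
  have h3 : (μ : ℝ) ^ (-(1 / 2) : ℝ) ≤ 1 / 8 := by
    rw [Real.rpow_neg hμ0.le, ← Real.sqrt_eq_rpow, one_div]
    refine inv_anti₀ (by norm_num) (Real.le_sqrt_of_sq_le ?_)
    have : (64 : ℝ) ≤ μ := by exact_mod_cast hμ
    linarith
  calc _ ≤ ((μ : ℝ) ^ (q + 1)) ^ (-1 + 1 / (2 * ((q : ℝ) + 1))) * (μ : ℝ) ^ q := by gcongr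
    _ ≤ 1 / 8 := by rw [h2]; exact h3

/-- On [0, 1] the value of `Real.log` is nonpositive, also at 0 by convention, so the positive
quotient already forces x > 1. -/
theorem pow_le_of_le_log_div_log {x y : ℝ} {k : ℕ} (hy : 1 < y) (hx : 0 ≤ x) (hk : 0 < k)
    (h : (k : ℝ) ≤ Real.log y / Real.log x) : x ^ k ≤ y := by
  have hly := Real.log_pos hy
  have hk' : (0 : ℝ) < k := by exact_mod_cast hk
  have hlx : 0 < Real.log x := by
    by_contra! hle
    linarith [div_nonpos_of_nonneg_of_nonpos hly.le hle]
  have hx0 : 0 < x := lt_of_le_of_ne hx fun h0 => by simp [← h0] at hlx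
  have h1 := (le_div_iff₀ hlx).1 h
  rw [← Real.log_pow] at h1
  exact (Real.log_le_log_iff (by positivity) (by linarith)).1 h1

/-- Monotonicity of `log a / log` compares the values of `a` at two powers of `μ`. -/
theorem pow_mul_le_of_log_div_log_lt {a : ℝ → ℝ} {μ : ℝ} {q Q : ℕ} (hμ : 1 < μ)
    (hlt : Real.log (a (μ ^ (q + 1))) / Real.log (μ ^ (q + 1)) <
      Real.log (a (μ ^ (q + 2))) / Real.log (μ ^ (q + 2)))
    (hpos : 0 < a (μ ^ (q + 1))) (hbig : (μ ^ (q + 2)) ^ Q ≤ a (μ ^ (q + 2))) :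
    a (μ ^ (q + 1)) * μ ^ Q < a (μ ^ (q + 2)) := by
  have hμ0 : 0 < μ := by linarith
  have hl := Real.log_pos hμ
  set A := a (μ ^ (q + 1))
  set B := a (μ ^ (q + 2))
  have hB : 0 < B := lt_of_lt_of_le (by positivity) hbig
  rw [Real.log_pow, Real.log_pow, div_lt_div_iff₀ (by positivity) (by positivity)] at hlt
  have h1 := Real.log_le_log (by positivity) hbig
  rw [Real.log_pow, Real.log_pow] at h1
  push_cast at hlt h1
  -- That is, A^(q+2) < B^(q+1). Together with μ^((q+2)Q) ≤ B this gives (A μ^Q)^(q+2) < B^(q+2).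
  have h2 : Real.log A * ((q : ℝ) + 2) < Real.log B * ((q : ℝ) + 1) := by
    refine lt_of_mul_lt_mul_right (a := Real.log μ) ?_ hl.le
    linarith
  refine (Real.log_lt_log_iff (by positivity) hB).1 ?_
  rw [Real.log_mul hpos.ne' (by positivity), Real.log_pow]
  refine lt_of_mul_lt_mul_right (a := (q : ℝ) + 2) ?_ (by positivity)
  linarith

theorem lt_of_floor_le_of_lt {u v : ℝ → ℝ} {x₀ R : ℝ} (hu : StrictMonoOn u (Set.Ici x₀))
    (hmaps : Set.MapsTo v (Set.Ici (u x₀)) (Set.Ici x₀))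
    (hinv : Set.RightInvOn v u (Set.Ici (u x₀))) (hR : u x₀ ≤ R) {m : ℕ} (hm : x₀ ≤ m) {N : ℕ}
    (hN : (N : ℝ) + 1 ≤ R) (hmN : ⌊u (m : ℝ)⌋ ≤ N) : (m : ℝ) < v R := by
  rw [← hu.lt_iff_lt (Set.mem_Ici.2 hm) (hmaps hR), hinv hR]
  have h1 := Int.lt_floor_add_one (u (m : ℝ))
  have h2 : ((⌊u (m : ℝ)⌋ : ℤ) : ℝ) ≤ N := by exact_mod_cast hmN
  linarith

-- The scale is n = μ^(q+2), N = ⌊a(n)⌋ with μ large. The count for `a` is about n; the one for `u`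
-- is governed by v(a(n+1)), a tiny power of b(a(n+1)) = n + 1; relative gaps are controlled by the
-- logarithmic derivative of `a`.
set_option maxHeartbeats 1000000 in
theorem exists_sparse_scale {m₀ k l : ℕ} {a u b v : ℝ → ℝ} {x₀ y₀ : ℝ}
    (hkm : m₀ < k) (ha : StrictMonoOn a (Set.Ici (k : ℝ)))
    (hafl : StrictMonoOn (fun m : ℕ => ⌊a (m : ℝ)⌋) (Set.Ici k)) (hapos : 1 ≤ ⌊a (k : ℝ)⌋)
    (ha_top : Filter.Tendsto a Filter.atTop Filter.atTop)
    (hba : Set.LeftInvOn b a (Set.Ici x₀))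
    (hy₀ : y₀ ≤ l) (hu : StrictMonoOn u (Set.Ici y₀))
    (hvmaps : Set.MapsTo v (Set.Ici (u y₀)) (Set.Ici y₀))
    (hvinv : Set.RightInvOn v u (Set.Ici (u y₀))) (hy₀0 : 0 ≤ y₀)
    (ha_log : UltimatelyIncreasing (fun R : ℝ => Real.log (a R) / Real.log R))
    (ha_lim : Filter.Tendsto (fun R : ℝ => Real.log (a R) / Real.log R)
      Filter.atTop Filter.atTop)
    (ha_diff : DifferentiableOn ℝ a (Set.Ici (m₀ : ℝ)))
    (ha_deriv : ∀ ε : ℝ, 0 < ε → ∃ C : ℝ, 0 < C ∧ ∀ R : ℝ, C ≤ R →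
      deriv (fun x : ℝ => Real.log (a x)) R < R ^ (-1 + ε))
    (hbv : Filter.Tendsto (fun R : ℝ => Real.log (b R) / Real.log (v R))
      Filter.atTop Filter.atTop) (q Q Z : ℕ) :
    ∃ N μ : ℕ, Z ≤ μ ∧ μ ^ Q ≤ N ∧ (floorSet a k ∩ Set.Iic N).ncard ≤ μ ^ (q + 3) ∧
      (floorSet u l ∩ Set.Iic N).ncard ≤ μ ∧
      ∀ x ≤ N, N ≤ x * μ ^ Q → ∃ s ∈ floorSet a k, s ≤ x ∧ (x - s) * μ ^ q ≤ x := by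
  obtain ⟨x₁, hlog⟩ := ha_log
  obtain ⟨C, -, hder⟩ := ha_deriv (1 / (2 * ((q : ℝ) + 1))) (by positivity)
  have hnt : Filter.Tendsto (fun μ : ℕ => ((μ ^ (q + 2) : ℕ) : ℝ)) Filter.atTop Filter.atTop :=
    tendsto_natCast_atTop_atTop.comp (Filter.tendsto_pow_atTop (by omega))
  have hnt1 : Filter.Tendsto (fun μ : ℕ => ((μ ^ (q + 2) + 1 : ℕ) : ℝ)) Filter.atTop
      Filter.atTop :=
    tendsto_natCast_atTop_atTop.comp (Filter.tendsto_atTop_mono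
      (fun μ => Nat.le_succ (μ ^ (q + 2))) (Filter.tendsto_pow_atTop (by omega)))
  -- The spare power ensures that N ≤ x μ^Q still forces x ≥ n.
  have hpow := eventually_pow_le_of_log_div_log ha_top ha_lim (Q + 1)
  obtain ⟨μ, hμ, hμx₀, hμx₁, hμC, hbig, hR, hRu⟩ :=
    ((Filter.eventually_ge_atTop (Z + k + 64 + ⌊a (k : ℝ)⌋.toNat)).and <|
      (tendsto_natCast_atTop_atTop.eventually_ge_atTop x₀).and <|
      (tendsto_natCast_atTop_atTop.eventually_ge_atTop x₁).and <|
      (tendsto_natCast_atTop_atTop.eventually_ge_atTop C).and <|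
      (hnt.eventually hpow).and <|
      ((ha_top.comp hnt1).eventually (hbv.eventually_ge_atTop ((2 * (q + 3) : ℕ) : ℝ))).and <|
      (ha_top.comp hnt1).eventually_ge_atTop (u y₀)).exists
  rw [Function.comp_apply] at hR hRu
  set n := μ ^ (q + 2) with hn
  have hμ1 : 1 ≤ μ := by omega
  have hp (j : ℕ) : 1 ≤ μ ^ j := Nat.one_le_pow _ _ hμ1
  have hμn : μ ≤ n := Nat.le_self_pow (by omega) μ
  have hfl_le {i j : ℕ} (hi : k ≤ i) (hij : i ≤ j) : ⌊a (i : ℝ)⌋ ≤ ⌊a (j : ℝ)⌋ :=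
    hafl.monotoneOn (Set.mem_Ici.2 hi) (Set.mem_Ici.2 (hi.trans hij)) hij
  have hapos' {y : ℝ} (hy : (k : ℝ) ≤ y) : 1 ≤ a y := by
    have h1 : (1 : ℝ) ≤ (⌊a (k : ℝ)⌋ : ℝ) := by exact_mod_cast hapos
    exact h1.trans ((Int.floor_le _).trans
      (ha.monotoneOn (Set.mem_Ici.2 le_rfl) (Set.mem_Ici.2 hy) hy))
  have hNcast : ((⌊a (n : ℝ)⌋.toNat : ℕ) : ℤ) = ⌊a (n : ℝ)⌋ :=
    Int.toNat_of_nonneg (by have := hfl_le le_rfl (by omega : k ≤ n); omega)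
  set N := ⌊a (n : ℝ)⌋.toNat with hN
  have hNa : (N : ℝ) ≤ a n := by
    have := Int.floor_le (a (n : ℝ))
    rw [← hNcast] at this
    exact_mod_cast this
  have haN : a n < N + 1 := by
    have := Int.lt_floor_add_one (a (n : ℝ))
    rw [← hNcast] at this
    exact_mod_cast this
  have hnN : n ^ (Q + 1) ≤ N := by
    have : ((n ^ (Q + 1) : ℕ) : ℤ) ≤ ⌊a (n : ℝ)⌋ := Int.le_floor.2 (by exact_mod_cast hbig)
    omega
  have hN1 : (N : ℝ) + 1 ≤ a ((n + 1 : ℕ) : ℝ) := by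
    have h1 : ⌊a (n : ℝ)⌋ < ⌊a ((n + 1 : ℕ) : ℝ)⌋ :=
      hafl (Set.mem_Ici.2 (by omega)) (Set.mem_Ici.2 (by omega)) (Nat.lt_succ_self n)
    have h2 : ((N : ℤ) + 1 : ℤ) ≤ ⌊a ((n + 1 : ℕ) : ℝ)⌋ := by omega
    exact_mod_cast Int.le_floor.1 h2
  refine ⟨N, μ, by omega, ?_, ?_, ?_, ?_⟩
  · refine le_trans ?_ hnN
    calc μ ^ Q ≤ n ^ Q := Nat.pow_le_pow_left hμn Q
      _ ≤ n ^ (Q + 1) := Nat.pow_le_pow_right (hp _) (Nat.le_succ Q)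
  · refine (ncard_floorSet_inter_Iic_le (n := n + 1) fun m hm hmN => ?_).trans ?_
    · by_contra! hlt
      have h1 : ⌊a (n : ℝ)⌋ < ⌊a (m : ℝ)⌋ :=
        hafl (Set.mem_Ici.2 (by omega)) (Set.mem_Ici.2 hm) hlt
      omega
    · rw [show q + 3 = q + 2 + 1 by ring, pow_succ, ← hn]
      have h64 := Nat.mul_le_mul_left n (by omega : 64 ≤ μ)
      have := hp (q + 2)
      omega
  · set R := a ((n + 1 : ℕ) : ℝ) with hRdef
    have hv0 : 0 ≤ v R := hy₀0.trans (hvmaps hRu)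
    have hbR : b R = ((n + 1 : ℕ) : ℝ) := hba (Set.mem_Ici.2 (hμx₀.trans
      (by exact_mod_cast (by omega : μ ≤ n + 1))))
    rw [hbR] at hR
    have h1 := pow_le_of_le_log_div_log (by exact_mod_cast (by omega : 1 < n + 1)) hv0
      (by omega) hR
    -- The quotient of logarithms is at least 2(q+3), so v(R)^(2(q+3)) ≤ n + 1 ≤ μ^(q+3), and v(R) ≤
    -- √μ.
    have h2 : (v R ^ 2) ^ (q + 3) ≤ (μ : ℝ) ^ (q + 3) := by
      rw [← pow_mul]
      refine h1.trans ?_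
      rw [show q + 3 = q + 2 + 1 by ring, pow_succ (μ : ℝ)]
      have h3 : n + 1 ≤ n * μ := by
        have := Nat.mul_le_mul_left n (by omega : 64 ≤ μ)
        have := hp (q + 2)
        omega
      rw [hn] at h3 ⊢
      exact_mod_cast h3
    have h3 : v R ^ 2 ≤ μ := (pow_le_pow_iff_left₀ (by positivity) (by positivity) (by omega)).1 h2
    have hμ64 : (64 : ℝ) ≤ μ := by exact_mod_cast (by omega : 64 ≤ μ)
    have h4 : v R ≤ μ - 2 := by nlinarith
    refine (ncard_floorSet_inter_Iic_le (n := ⌈v R⌉₊) fun m hm hmN => ?_).trans ?_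
    · have := lt_of_floor_le_of_lt hu hvmaps hvinv hRu
        (hy₀.trans (by exact_mod_cast hm)) hN1 hmN
      exact Nat.lt_ceil.2 this
    · have h5 : ⌈v R⌉₊ ≤ μ - 2 := by
        rw [Nat.ceil_le, Nat.cast_sub (by omega)]
        exact_mod_cast h4
      omega
  · intro x hxN hNx
    have hxbig : n ≤ x := by
      refine Nat.le_of_mul_le_mul_right (c := μ ^ Q) ?_ (hp Q)
      refine le_trans ?_ (hnN.trans hNx)
      rw [pow_succ, mul_comm]
      exact Nat.mul_le_mul_right _ (Nat.pow_le_pow_left hμn Q)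
    have hkx : ⌊a (k : ℝ)⌋ ≤ x := by
      omega
    obtain ⟨m, hm, hmx, hxm⟩ := exists_le_lt_succ hafl (x := (x : ℤ)) hkx
    have hxa : (x : ℝ) + 1 ≤ a ((m + 1 : ℕ) : ℝ) := by
      have : ((x : ℤ) + 1 : ℤ) ≤ ⌊a ((m + 1 : ℕ) : ℝ)⌋ := hxm
      exact_mod_cast Int.le_floor.1 this
    have hμp : μ ≤ μ ^ (q + 1) := Nat.le_self_pow (by omega) μ
    have hμ1' : (1 : ℝ) < μ := by exact_mod_cast (by omega : 1 < μ)
    -- Otherwise x < a(μ^(q+1)), which is smaller than a(n) / μ^Q by the monotonicity of log a /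
    -- log; this contradicts N ≤ x μ^Q.
    have hmlow : μ ^ (q + 1) ≤ m := by
      by_contra! hlt
      have hkq : (k : ℝ) ≤ (μ : ℝ) ^ (q + 1) := by exact_mod_cast (by omega : k ≤ μ ^ (q + 1))
      have h1 : a ((m + 1 : ℕ) : ℝ) ≤ a ((μ : ℝ) ^ (q + 1)) :=
        ha.monotoneOn (Set.mem_Ici.2 (by exact_mod_cast (by omega : k ≤ m + 1)))
          (Set.mem_Ici.2 hkq) (by exact_mod_cast hlt)
      have hncast : (n : ℝ) = (μ : ℝ) ^ (q + 2) := by rw [hn]; push_cast; rfl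
      have hx₁ : x₁ ≤ (μ : ℝ) ^ (q + 1) := hμx₁.trans (le_self_pow₀ hμ1'.le (by omega))
      have hqq : (μ : ℝ) ^ (q + 1) < (μ : ℝ) ^ (q + 2) := pow_lt_pow_right₀ hμ1' (by omega)
      have h2 := pow_mul_le_of_log_div_log_lt (Q := Q) hμ1'
        (hlog (Set.mem_Ici.2 hx₁) (Set.mem_Ici.2 (hx₁.trans hqq.le)) hqq)
        (by linarith [hapos' hkq]) (by
          rw [← hncast]
          refine le_trans ?_ hbig
          exact pow_le_pow_right₀ (by exact_mod_cast hp (q + 2)) (Nat.le_succ Q))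
      rw [← hncast] at h2
      have h3 : (N : ℝ) + 1 ≤ (x + 1) * (μ : ℝ) ^ Q := by
        have h4 := hp Q
        have : N + 1 ≤ (x + 1) * μ ^ Q := by rw [add_mul, one_mul]; omega
        exact_mod_cast this
      have h4 : ((x : ℝ) + 1) * (μ : ℝ) ^ Q ≤ a ((μ : ℝ) ^ (q + 1)) * (μ : ℝ) ^ Q := by
        gcongr
        exact hxa.trans h1
      linarith
    have hflm := hfl_le le_rfl hm
    have hs : ((⌊a (m : ℝ)⌋.toNat : ℕ) : ℤ) = ⌊a (m : ℝ)⌋ := Int.toNat_of_nonneg (by omega)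
    set s := ⌊a (m : ℝ)⌋.toNat
    refine ⟨s, Or.inr ⟨m, hm, hs⟩, by omega, ?_⟩
    have hsx : s ≤ x := by omega
    have hm_le : (μ : ℝ) ^ (q + 1) ≤ (m : ℝ) := by exact_mod_cast hmlow
    have hδ := rpow_mul_pow_le (q := q) (by omega : 64 ≤ μ) hm_le
    set δ := (m : ℝ) ^ (-1 + 1 / (2 * ((q : ℝ) + 1))) with hδdef
    have hδ0 : 0 ≤ δ := Real.rpow_nonneg m.cast_nonneg _
    have hm0 : (0 : ℝ) < m := lt_of_lt_of_le (by positivity) hm_le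
    have hkm' : (m₀ : ℝ) < m := by exact_mod_cast (by omega : m₀ < m)
    have hkm'' : (k : ℝ) ≤ m := by exact_mod_cast hm
    have hCm : C ≤ m := hμC.trans (by exact_mod_cast hμp.trans hmlow)
    have hδ1 : δ ≤ 1 := by
      have : (1 : ℝ) ≤ (μ : ℝ) ^ q := one_le_pow₀ hμ1'.le
      nlinarith
    have hgap := sub_le_of_deriv_log_lt (a := a) (x := (m : ℝ)) (δ := δ)
      (fun y hy => (ha_diff y (Set.mem_Ici.2 (hkm'.le.trans hy.1))).differentiableAt
        (Ici_mem_nhds (hkm'.trans_le hy.1)))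
      (fun y hy => by linarith [hapos' (hkm''.trans hy.1)])
      (fun y hy => (hder y (hCm.trans hy.1.le)).le.trans
        (Real.rpow_le_rpow_of_nonpos hm0 hy.1.le (by
          have : 1 / (2 * ((q : ℝ) + 1)) ≤ 1 := by
            rw [div_le_one (by positivity)]
            linarith [q.cast_nonneg (α := ℝ)]
          linarith))) hδ1 hδ0
    have has : a m < s + 1 := by
      have := Int.lt_floor_add_one (a (m : ℝ))
      rw [← hs] at this
      exact_mod_cast this
    have hx1 : (1 : ℝ) ≤ x := by exact_mod_cast (hp (q + 2)).trans hxbig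
    have hsx' : (s : ℝ) ≤ x := by exact_mod_cast hsx
    rw [Nat.cast_succ] at hxa
    have hfin : ((x : ℝ) - s) * (μ : ℝ) ^ q ≤ x := by
      -- The two roundings cancel: x + 1 ≤ a(m+1) and a(m) < s + 1 give x - s < a(m+1) - a(m) ≤ 2δ
      -- a(m), while a(m) < s + 1 ≤ 2x.
      have h1 : (x : ℝ) - s ≤ 4 * δ * x := by
        have : 2 * δ * a m ≤ 2 * δ * (2 * x) := by gcongr; linarith
        linarith
      calc ((x : ℝ) - s) * (μ : ℝ) ^ q ≤ (4 * δ * x) * (μ : ℝ) ^ q := by gcongr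
        _ = 4 * (δ * (μ : ℝ) ^ q) * x := by ring
        _ ≤ 4 * (1 / 8) * x := by gcongr
        _ ≤ x := by linarith
    rw [← Nat.cast_sub hsx] at hfin
    exact_mod_cast hfin

theorem mainTheorem6 (m₀ : ℕ) (a u b v : ℝ → ℝ)
    -- only the values of `a` and `u` on `[m₀, ∞)` matter
    (ha : UltimatelyIncreasing a) (hu : UltimatelyIncreasing u)
    (ha_floor : UltimatelyIncreasing (fun m : ℕ => ⌊a (m : ℝ)⌋))
    (hu_floor : UltimatelyIncreasing (fun m : ℕ => ⌊u (m : ℝ)⌋))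
    (hb : IsUltimateInverse m₀ a b) (hv : IsUltimateInverse m₀ u v)
    (ha_log : UltimatelyIncreasing (fun R : ℝ => Real.log (a R) / Real.log R))
    (ha_lim : Filter.Tendsto (fun R : ℝ => Real.log (a R) / Real.log R)
      Filter.atTop Filter.atTop)
    (ha_diff : DifferentiableOn ℝ a (Set.Ici (m₀ : ℝ)))
    (ha_deriv : ∀ ε : ℝ, 0 < ε → ∃ C : ℝ, 0 < C ∧ ∀ R : ℝ, C ≤ R →
      deriv (fun x : ℝ => Real.log (a x)) R < R ^ (-1 + ε))
    (hu_ratio : ∃ C : ℝ, 0 < C ∧ ∀ᶠ R : ℝ in Filter.atTop, u (R + 1) / u R < C)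
    (hbv : Filter.Tendsto (fun R : ℝ => Real.log (b R) / Real.log (v R))
      Filter.atTop Filter.atTop)
    (β : ℝ) (hβ : IsPisotNumber β ∨ IsSalemNumber β) :
    Summable (fun n : ℕ => β ^ (-⌊a ((m₀ + n : ℕ) : ℝ)⌋)) ∧
    Summable (fun n : ℕ => β ^ (-⌊u ((m₀ + n : ℕ) : ℝ)⌋)) ∧
    AlgebraicIndependent ℚ
      ![∑' n : ℕ, β ^ (-⌊a ((m₀ + n : ℕ) : ℝ)⌋),
        ∑' n : ℕ, β ^ (-⌊u ((m₀ + n : ℕ) : ℝ)⌋)] := by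
  obtain ⟨hβ₁, hβint, hconj⟩ : 1 < β ∧ IsIntegral ℤ β ∧
      ∀ z ∈ (minpoly ℚ β).aroots ℂ, z ≠ (β : ℂ) → ‖z‖ ≤ 1 := by
    rcases hβ with ⟨h1, h2, h3⟩ | ⟨h1, h2, h3, -⟩
    · exact ⟨h1, h2, fun z hz hne => (h3 z hz hne).le⟩
    · exact ⟨h1, h2, h3⟩
  have hβalg : IsAlgebraic ℚ β := (hβint.tower_top (A := ℚ)).isAlgebraic
  have ha_top := tendsto_atTop_of_ultimatelyIncreasing_floor ha ha_floor
  have hu_top := tendsto_atTop_of_ultimatelyIncreasing_floor hu hu_floor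
  obtain ⟨xa, -, ha_mono, -, hba, -⟩ := hb
  obtain ⟨xu, hxu, hu_mono, hvmaps, -, hvinv⟩ := hv
  obtain ⟨ka, ha_floor⟩ := ha_floor
  obtain ⟨ku, hu_floor⟩ := hu_floor
  obtain ⟨C, hC, hu_ratio⟩ := hu_ratio
  obtain ⟨k, hk₁, hk₂, hk₃, hk₄⟩ := ((Filter.eventually_gt_atTop m₀).and <|
    (Filter.eventually_ge_atTop ka).and <|
    (tendsto_natCast_atTop_atTop.eventually_ge_atTop xa).and <|
    (ha_top.comp tendsto_natCast_atTop_atTop).eventually_ge_atTop 1).exists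
  obtain ⟨r, hr⟩ := Filter.eventually_atTop.1 hu_ratio
  obtain ⟨l, hl₁, hl₂, hl₃, hl₄, hl₅⟩ := ((Filter.eventually_ge_atTop m₀).and <|
    (Filter.eventually_ge_atTop ku).and <|
    (tendsto_natCast_atTop_atTop.eventually_ge_atTop xu).and <|
    (tendsto_natCast_atTop_atTop.eventually_ge_atTop r).and <|
    (hu_top.comp tendsto_natCast_atTop_atTop).eventually_ge_atTop 1).exists
  have hafl := ha_floor.mono (Set.Ici_subset_Ici.2 hk₂)
  have hufl := hu_floor.mono (Set.Ici_subset_Ici.2 hl₂)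
  have hapos : 1 ≤ ⌊a (k : ℝ)⌋ := Int.le_floor.2 (by exact_mod_cast hk₄)
  have hupos : 1 ≤ ⌊u (l : ℝ)⌋ := Int.le_floor.2 (by exact_mod_cast hl₅)
  obtain ⟨hsa, ca, hca, hta⟩ := summable_and_tsum_eq hβ₁ hβalg hk₁.le hafl hapos
  obtain ⟨hsu, cu, hcu, htu⟩ := summable_and_tsum_eq hβ₁ hβalg hl₁ hufl hupos
  refine ⟨hsa, hsu, ?_⟩
  have hindep := algebraicIndependent_sparseSum hβ₁ hβint hconj
    (S := floorSet a k) (T := floorSet u l) (Set.mem_insert _ _) (Set.mem_insert _ _)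
    (exists_mem_floorSet_le_mul hufl hupos hC fun m hm =>
      hr m (hl₄.trans (by exact_mod_cast hm)))
    (exists_sparse_scale hk₁ (ha_mono.mono (Set.Ici_subset_Ici.2 hk₃)) hafl hapos ha_top hba
      hl₃ hu_mono hvmaps hvinv ((Nat.cast_nonneg m₀).trans hxu) ha_log ha_lim ha_diff ha_deriv hbv)
  -- The series differ from the sums over the digit sets by the algebraic numbers `ca` and `cu`.
  have h := hindep.add_isAlgebraic (c := ![ca, cu]) fun i => by
    fin_cases i
    · exact hca
    · exact hcu
  rw [hta, htu]
  convert! h using 1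
  funext i
  fin_cases i <;> rfl
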